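/- **Model.** In each round $t=0,1,2,\dots$ a seller auctions one ad slot to $n$ advertisers. Their values $v_1,\dots,v_n\ge 0$ are drawn afresh and independently, $v_i$ from a distribution with CDF $F_i$, density $f_i$ and finite expectation, which is regular: the virtual value $\phi_i(v)=v-\frac{1-F_i(v)}{f_i(v)}$ is non-decreasing on the support $\{f_i>0\}$, an interval. The state is the user's click-through rate $\mathrm{ctr}_t\in[0,1]$. If ad $i$ is shown in state $\mathrm{ctr}$, the next state has law $P_i(\cdot\mid\mathrm{ctr})$; if no ad is shown, it has law $P_0(\cdot\mid\mathrm{ctr})$ ($P_0,\dots,P_n$ are Markov kernels on $[0,1]$). A mechanism $a$ consists of winning probabilities $x_i(b)\in[0,1]$ with $\sum_i x_i(b)\le 1$ and expected payments $p_i(b)\ge 0$, as functions of the bids $b\in\mathbb R_{\ge0}^n$, such that truthful bidding is a dominant strategy and truthful bidders have non-negative utility. Its one-round reward is $R(a,\mathrm{ctr})=\mathrm{ctr}\cdot\mathbb E_v[\sum_i p_i(v)]$. A policy $\pi$ chooses a mechanism in every state (measurably); for a discount factor $\gamma\in[0,1)$ its value is $V^\pi(\mathrm{ctr})=\mathbb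 E\big[\sum_{t\ge0}\gamma^t R(\pi(\mathrm{ctr}_t),\mathrm{ctr}_t)\mid \mathrm{ctr}_0=\mathrm{ctr}\big]$, and $V^*(\mathrm{ctr})=\sup_\pi V^\pi(\mathrm{ctr})$. A *two-stage second-price auction with personalized reserves* for a partition $S_1\sqcup S_2$ of the advertisers: draw a fresh sample of values of the bidders in $S_2$ from their distributions, independent of the bids, and compute from it reserves $r_i\in[0,\infty]$, $i\in S_1$. First stage: among the bidders $i\in S_1$ with $b_i\ge r_i$ the highest bidder wins (ties are broken by index) and pays the larger of the own reserve and the highest other bid among these bidders. Second stage: if the first stage has no winner, then with some probability $\theta$ a second-price auction without reserves is run among the bidders in $S_2$. **Theorem.** Assume that every ad $i$ has a quality $q_i$ in a set with two elements and that the user's transitions depend only on the quality of the ad shown: $P_i=P_j$ whenever $q_i=q_j$. Then there is a policy $\pi$ that, in every state, runs a two-stage second-price auction with personalized reserves, with $S_1$ the set of ads of one of the two qualities, and that satisfies $$V^\pi(\mathrm{ctr})\ \ge\ \tfrac18\,V^*(\mathrm{ctr})\qquad\text{for all }\mathrm{ctr}\in[0,1].$$ Moreover, $\pi$ can be chosen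 such that for some optimal policy $\pi^*$ (that is, $V^{\pi^*}=V^*$ in all states), in every state, $\pi$ and $\pi^*$ show an ad of each quality with exactly the same probability, $\pi$ obtains at least $\frac18$ of the one-round reward of $\pi^*$, and the state processes of $\pi$ and $\pi^*$ from any given initial state have the same law in every round. -/

import Mathlib

open MeasureTheory ProbabilityTheory
open scoped NNReal ENNReal

noncomputable section

/-- A value distribution on `[0, ∞)` given by a density, with finite expectation. -/
structure ValueDistribution where
  pdf : ℝ → ℝ
  measurable_pdf : Measurable pdf
  pdf_nonneg : ∀ v, 0 ≤ pdf v
  pdf_of_neg : ∀ v, v < 0 → pdf v = 0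
  lintegral_pdf : ∫⁻ v, ENNReal.ofReal (pdf v) = 1
  finite_mean : ∫⁻ v, ENNReal.ofReal v * ENNReal.ofReal (pdf v) < ∞

namespace ValueDistribution

/-- The probability measure with density `pdf`. -/
def law (F : ValueDistribution) : Measure ℝ :=
  volume.withDensity fun v => ENNReal.ofReal (F.pdf v)

instance (F : ValueDistribution) : IsProbabilityMeasure F.law :=
  ⟨by rw [law, withDensity_apply _ MeasurableSet.univ, Measure.restrict_univ, F.lintegral_pdf]⟩

/-- The virtual value `φ(v) = v - (1 - F(v)) / f(v)`; it is used only where `f(v) > 0`. -/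
def virtualValue (F : ValueDistribution) (v : ℝ) : ℝ :=
  v - (1 - cdf F.law v) / F.pdf v

/-- Regularity: the virtual value is non-decreasing on the support, which is an interval.
(With the usual convention `φ(v) = -∞` where `f(v) = 0` and `F(v) < 1`, a non-decreasing `φ`
forces the density to stay positive from the first point of the support to the last.) -/
def Regular (F : ValueDistribution) : Prop :=
  {v | 0 < F.pdf v}.OrdConnected ∧ MonotoneOn F.virtualValue {v | 0 < F.pdf v}

end ValueDistribution

/-- A single-slot, possibly randomized, incentive compatible mechanism for `n` bidders.  Bids are
non-negative reals; `alloc b i` is the probability that `i` wins, and `pay b i` is the expected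
payment of `i`, when the bid vector is `b`. -/
structure Mechanism (n : ℕ) where
  alloc : (Fin n → ℝ) → Fin n → ℝ
  pay : (Fin n → ℝ) → Fin n → ℝ
  measurable_alloc : Measurable alloc
  measurable_pay : Measurable pay
  alloc_nonneg : ∀ b, 0 ≤ b → ∀ i, 0 ≤ alloc b i
  sum_alloc_le_one : ∀ b, 0 ≤ b → ∑ i, alloc b i ≤ 1
  pay_nonneg : ∀ b, 0 ≤ b → ∀ i, 0 ≤ pay b i
  /-- Truthful bidding is optimal for every bidder whatever the others bid. -/
  incentive_compatible : ∀ v, 0 ≤ v → ∀ i, ∀ b : ℝ, 0 ≤ b →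
    v i * alloc (Function.update v i b) i - pay (Function.update v i b) i
      ≤ v i * alloc v i - pay v i
  /-- A truthful bidder never has negative utility.  Given incentive compatibility and
  non-negative payments this says that a bid of `0` pays `0`, the normalization in Myerson's
  payment identity. -/
  individually_rational : ∀ v, 0 ≤ v → ∀ i, 0 ≤ v i * alloc v i - pay v i

/-- The repeated single-slot ad auction: the value distributions of the `n` advertisers, the
transition kernels of the click-through rate when ad `i` is shown (`P (some i)`) or no ad is shown
(`P none`), and the discount factor. -/
structure AdMDP (n : ℕ) where
  dist : Fin n → ValueDistribution
  P : Option (Fin n) → Kernel unitInterval unitInterval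
  markov : ∀ o, IsMarkovKernel (P o)
  γ : ℝ≥0
  γ_lt_one : γ < 1

namespace AdMDP

variable {n : ℕ} (M : AdMDP n)

/-- The values of the advertisers in one round: independent draws. -/
def valueLaw : Measure (Fin n → ℝ) := Measure.pi fun i => (M.dist i).law

instance : IsProbabilityMeasure M.valueLaw := by unfold valueLaw; infer_instance

/-- The probability that mechanism `a` shows ad `i` (`some i`), or no ad (`none`). -/
def showProb (a : Mechanism n) : Option (Fin n) → ℝ≥0∞
  | some i => ∫⁻ v, ENNReal.ofReal (a.alloc v i) ∂M.valueLaw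
  | none => ∫⁻ v, ENNReal.ofReal (1 - ∑ i, a.alloc v i) ∂M.valueLaw

/-- The expected total payment `E_v[∑ i, p_i(v)]` collected by mechanism `a`. -/
def expectedPayment (a : Mechanism n) : ℝ≥0∞ :=
  ∫⁻ v, ENNReal.ofReal (∑ i, a.pay v i) ∂M.valueLaw

/-- The one-round reward `R(a, ctr) = ctr * E_v[∑ i, p_i(v)]`. -/
def reward (a : Mechanism n) (ctr : unitInterval) : ℝ≥0∞ :=
  ENNReal.ofReal (ctr : ℝ) * M.expectedPayment a

/-- A (stationary) policy chooses a mechanism in every state.  The showing probabilities and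
the expected payment have to be measurable in the state, so that the state process and the
expected discounted revenue make sense. -/
structure Policy where
  mech : unitInterval → Mechanism n
  measurable_showProb : ∀ o, Measurable fun ctr => M.showProb (mech ctr) o
  measurable_expectedPayment : Measurable fun ctr => M.expectedPayment (mech ctr)

variable {M}

/-- The one-step transition of the state under a policy:
`P(· | a, ctr) = E_{W ∼ D^a}[P_W(· | ctr)]` with `a = π(ctr)`. -/
def Policy.transition (π : M.Policy) : Kernel unitInterval unitInterval where
  toFun ctr := ∑ o : Option (Fin n), M.showProb (π.mech ctr) o • M.P o ctr
  measurable' := by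
    refine Measure.measurable_of_measurable_coe _ fun s hs => ?_
    simp only [Measure.finsetSum_apply, Measure.smul_apply, smul_eq_mul]
    exact Finset.measurable_sum _ fun o _ =>
      (π.measurable_showProb o).mul ((M.P o).measurable_coe hs)

/-- The law of the state `ctr_t` in round `t`, when `ctr_0 = ctr₀` and policy `π` is used. -/
def Policy.stateLaw (π : M.Policy) (ctr₀ : unitInterval) : ℕ → Measure unitInterval
  | 0 => Measure.dirac ctr₀
  | t + 1 => (π.stateLaw ctr₀ t).bind π.transition

/-- The long-term discounted revenue `V^π(ctr₀) = ∑ t, γ ^ t * E[R(π(ctr_t), ctr_t)]`.  All terms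
are non-negative, so this is a well-defined element of `[0, ∞]`, and it is also the expectation of
the discounted sum. -/
def Policy.value (π : M.Policy) (ctr₀ : unitInterval) : ℝ≥0∞ :=
  ∑' t : ℕ, (M.γ : ℝ≥0∞) ^ t * ∫⁻ ctr, M.reward (π.mech ctr) ctr ∂π.stateLaw ctr₀ t

variable (M)

/-- The optimal long-term discounted revenue `V^*(ctr) = sup_π V^π(ctr)`. -/
def optValue (ctr : unitInterval) : ℝ≥0∞ := ⨆ π : M.Policy, π.value ctr

end AdMDP

section SecondPrice

variable {n : ℕ}

/-- The bidders in `S` who meet their personalized reserve (`∞` excludes a bidder). -/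
def eligible (S : Finset (Fin n)) (r : Fin n → ℝ≥0∞) (b : Fin n → ℝ) : Finset (Fin n) :=
  S.filter fun i => r i ≤ ENNReal.ofReal (b i)

/-- In the second-price auction among `S` with eager reserves `r`, the winner is the highest
eligible bidder; ties go to the smaller index. -/
def SpaWins (S : Finset (Fin n)) (r : Fin n → ℝ≥0∞) (b : Fin n → ℝ) (i : Fin n) : Prop :=
  i ∈ eligible S r b ∧ ∀ j ∈ eligible S r b, j ≠ i → b j < b i ∨ (b j = b i ∧ i < j)

open Classical in
/-- Allocation of the second-price auction among `S` with reserves `r`. -/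
def spaAlloc (S : Finset (Fin n)) (r : Fin n → ℝ≥0∞) (b : Fin n → ℝ) (i : Fin n) : ℝ :=
  if SpaWins S r b i then 1 else 0

open Classical in
/-- Payment in the second-price auction among `S` with reserves `r`: the winner pays the larger of
the own reserve and the highest bid of the other eligible bidders (if there are any). -/
def spaPay (S : Finset (Fin n)) (r : Fin n → ℝ≥0∞) (b : Fin n → ℝ) (i : Fin n) : ℝ :=
  if SpaWins S r b i then
    max (r i).toReal ((((eligible S r b).erase i).sup fun j => (b j).toNNReal : ℝ≥0) : ℝ)
  else 0

/-- The parameters of a two-stage second-price auction.  The bidders are split into `S₁` and its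
complement `S₂`.  A fresh sample of values, independent of the bids, is drawn from the value
distributions of the bidders in `S₂`, and the personalized reserves of the bidders in `S₁` are
computed from it. -/
structure TwoStage (n : ℕ) where
  S₁ : Finset (Fin n)
  reserve : (Fin n → ℝ) → Fin n → ℝ≥0∞
  measurable_reserve : Measurable reserve
  dependsOn_reserve : DependsOn reserve {j | j ∉ S₁}
  θ : ℝ
  θ_nonneg : 0 ≤ θ
  θ_le_one : θ ≤ 1

namespace TwoStage

variable (T : TwoStage n)

open Classical in
/-- The probability, over the sample `s`, that the first stage has no winner. -/
def noWinnerProb (D : Measure (Fin n → ℝ)) (b : Fin n → ℝ) : ℝ :=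
  ∫ s, (if eligible T.S₁ (T.reserve s) b = ∅ then 1 else 0) ∂D

/-- First stage: a second-price auction among `S₁` with the personalized reserves.  Second stage:
if the first has no winner, then with probability `θ` a second-price auction without reserves
among the bidders in `S₂`. -/
def alloc (D : Measure (Fin n → ℝ)) (b : Fin n → ℝ) (i : Fin n) : ℝ :=
  ∫ s, spaAlloc T.S₁ (T.reserve s) b i ∂D + T.noWinnerProb D b * T.θ * spaAlloc T.S₁ᶜ 0 b i

/-- The expected payments in the two-stage auction. -/
def pay (D : Measure (Fin n → ℝ)) (b : Fin n → ℝ) (i : Fin n) : ℝ :=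
  ∫ s, spaPay T.S₁ (T.reserve s) b i ∂D + T.noWinnerProb D b * T.θ * spaPay T.S₁ᶜ 0 b i

end TwoStage

end SecondPrice

namespace AdMDP

variable {n : ℕ} (M : AdMDP n)

/-- The mechanism `a` is the two-stage second-price auction with parameters `T`. -/
def IsTwoStage (a : Mechanism n) (T : TwoStage n) : Prop :=
  ∀ b : Fin n → ℝ, 0 ≤ b →
    a.alloc b = T.alloc M.valueLaw b ∧ a.pay b = T.pay M.valueLaw b

open Classical in
/-- The probability that mechanism `a` shows an ad of quality `c`. -/
def qualityProb {Q : Type*} (q : Fin n → Q) (a : Mechanism n) (c : Q) : ℝ≥0∞ :=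
  ∑ i with q i = c, M.showProb a (some i)

end AdMDP

end

/-! The transition out of a state depends on the mechanism only through the probabilities of showing
an ad of each quality and of showing nothing. So the plan is to take an optimal policy and to
replace its mechanism `a`, state by state, by a two-stage auction with the same three probabilities
and at least 1/8 of the expected payment. The state laws then agree in every round, and the bound on
the discounted value follows term by term (`Policy.value_div_le`).

An optimal policy exists by value iteration from 0. For given continuation values, one step
maximizes a weighted sum of revenue and showing probabilities. By Myerson's theory a maximizer is
the auction won by the largest nonnegative score, click-through rate times virtual value plus the
continuation weight of the ad (`weighted_revenue_le_scoreMech`). This explicit maximizer is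
measurable in the state, so the Bellman operator preserves measurability and its greedy policy
attains the limit of the iteration (`exists_optimal_policy`).

To compare revenues, let `a` show ad `i` with probability `q i`. Bidder `i` pays in expectation at
most (price met with probability `q i`) times `q i` (`meanPay_le_price_mul_winProb`): among
allocation rules of mean `q i`, a threshold maximizes a monotone virtual value. Run a second-price
auction among the bidders `S` of one quality with these prices as reserves. Its revenue is at least
every reserve that is met, and truncated inclusion-exclusion with independence gives at least half
the sum of these bounds (`half_sum_reserve_mul_le`).

With these reserves the first stage sells with probability at most the sum of the `q i` over `S`.
Changing the reserve of a single bidder `k` makes the two equal (`prod_one_sub_adjustAt`), and the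
second-stage probability then matches the other quality (`secondStageProb_mul`). The contribution of
`k` is given up, except when `k` is alone and its reserve does not change.

The constant is 8 = 2 · 2 · 2: the quality with the larger sum of bounds, the loss of its smallest
bidder `k`, and the half from inclusion-exclusion. The reserves used are constants for each state
and need no sample. -/

namespace ValueDistribution

/-! ### Virtual values and information rents for one value distribution -/

variable (F : ValueDistribution)

/-- The inverse hazard rate `(1 - F(v)) / f(v)`. -/
noncomputable def invHazard (v : ℝ) : ℝ := (1 - cdf F.law v) / F.pdf v

/-- The points that do not lie below the support. -/
def reached : Set ℝ := {v | ∃ u ≤ v, 0 < F.pdf u}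

open Classical in
/-- The virtual value, extended above the support so as to stay monotone. -/
noncomputable def extVirtualValue (v : ℝ) : ℝ := if 0 < F.pdf v then F.virtualValue v else v

instance : NullSingletonClass F.law :=
  ⟨fun x => withDensity_absolutelyContinuous _ _ (measure_singleton x)⟩

theorem measurableSet_support : MeasurableSet {v | 0 < F.pdf v} :=
  measurableSet_lt measurable_const F.measurable_pdf

theorem isUpperSet_reached : IsUpperSet F.reached :=
  fun _ _ hab ⟨u, hu, h⟩ => ⟨u, hu.trans hab, h⟩

theorem measurableSet_reached : MeasurableSet F.reached :=
  F.isUpperSet_reached.ordConnected.measurableSet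

theorem measurable_cdf : Measurable (cdf F.law) := (monotone_cdf F.law).measurable

theorem measurable_invHazard : Measurable F.invHazard :=
  (measurable_const.sub F.measurable_cdf).div F.measurable_pdf

theorem invHazard_nonneg (v : ℝ) : 0 ≤ F.invHazard v :=
  div_nonneg (sub_nonneg.2 (cdf_le_one _ _)) (F.pdf_nonneg v)

theorem virtualValue_eq (v : ℝ) : F.virtualValue v = v - F.invHazard v := rfl

theorem virtualValue_le (v : ℝ) : F.virtualValue v ≤ v := by
  rw [virtualValue_eq]; linarith [F.invHazard_nonneg v]

theorem measurable_extVirtualValue : Measurable F.extVirtualValue :=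
  Measurable.ite F.measurableSet_support (measurable_id.sub F.measurable_invHazard) measurable_id

theorem ae_pdf_pos : ∀ᵐ v ∂F.law, 0 < F.pdf v := by
  rw [law, ae_withDensity_iff F.measurable_pdf.ennreal_ofReal]
  filter_upwards with v hv
  simpa using hv

theorem nonneg_of_pdf_pos {v : ℝ} (h : 0 < F.pdf v) : 0 ≤ v := by
  by_contra hv
  exact h.ne' (F.pdf_of_neg v (not_le.1 hv))

theorem ae_nonneg : ∀ᵐ v ∂F.law, 0 ≤ v := by
  filter_upwards [F.ae_pdf_pos] with v hv using F.nonneg_of_pdf_pos hv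

theorem lintegral_law {g : ℝ → ℝ≥0∞} (hg : Measurable g) :
    ∫⁻ v, g v ∂F.law = ∫⁻ v, ENNReal.ofReal (F.pdf v) * g v :=
  lintegral_withDensity_eq_lintegral_mul _ F.measurable_pdf.ennreal_ofReal hg

theorem integrable_id : Integrable (fun v => v) F.law := by
  refine ⟨measurable_id.aestronglyMeasurable, ?_⟩
  rw [hasFiniteIntegral_iff_ofReal F.ae_nonneg,
    lintegral_law _ ENNReal.measurable_ofReal]
  simpa [mul_comm] using F.finite_mean

theorem law_Ioi (z : ℝ) : F.law (Set.Ioi z) = ENNReal.ofReal (1 - cdf F.law z) := by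
  rw [← Set.compl_Iic, prob_compl_eq_one_sub measurableSet_Iic, ← ofReal_cdf,
    ENNReal.ofReal_sub _ (cdf_nonneg _ _), ENNReal.ofReal_one]

theorem law_Ici (z : ℝ) : F.law (Set.Ici z) = ENNReal.ofReal (1 - cdf F.law z) := by
  rw [← law_Ioi]
  exact measure_congr Ioi_ae_eq_Ici.symm

variable {F}

/-- Above the support the extension is the identity, which dominates because a virtual value never
exceeds the value. The support is an interval, so it is not entered again after it has been left. -/
theorem Regular.monotoneOn_extVirtualValue (h : F.Regular) :
    MonotoneOn F.extVirtualValue F.reached := by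
  intro u hu v hv huv
  unfold extVirtualValue
  split_ifs with h1 h2 h2
  · exact h.2 h1 h2 huv
  · exact (F.virtualValue_le u).trans huv
  · obtain ⟨w, hw, hw'⟩ := hu
    exact absurd (h.1.out hw' h2 ⟨hw, huv⟩) h1
  · exact huv

theorem Regular.law_Ioi_eq_zero (h : F.Regular) {z : ℝ} (hz : z ∈ F.reached)
    (h0 : ¬ 0 < F.pdf z) : F.law (Set.Ioi z) = 0 := by
  rw [law, withDensity_apply _ measurableSet_Ioi]
  refine (setLIntegral_congr_fun measurableSet_Ioi fun v hv => ?_).trans lintegral_zero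
  obtain ⟨u, hu, hu'⟩ := hz
  rw [ENNReal.ofReal_eq_zero]
  by_contra hv'
  exact h0 (h.1.out hu' (not_le.1 hv') ⟨hu, (le_of_lt hv)⟩)

/-- Tonelli: the expected information rent. -/
theorem lintegral_rent {g : ℝ → ℝ≥0∞} (hg : Measurable g) :
    ∫⁻ v, (∫⁻ z in Set.Ioc 0 v, g z) ∂F.law
      = ∫⁻ z in Set.Ioi 0, g z * ENNReal.ofReal (1 - cdf F.law z) := by
  have hm : Measurable fun p : ℝ × ℝ => (Set.Ioc 0 p.1).indicator g p.2 := by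
    have : (fun p : ℝ × ℝ => (Set.Ioc 0 p.1).indicator g p.2)
        = {p : ℝ × ℝ | 0 < p.2 ∧ p.2 ≤ p.1}.indicator fun p => g p.2 := by
      ext p; simp [Set.indicator, Set.mem_Ioc]
    rw [this]
    exact (hg.comp measurable_snd).indicator ((measurableSet_lt measurable_const measurable_snd).inter
      (measurableSet_le measurable_snd measurable_fst))
  simp_rw [← lintegral_indicator measurableSet_Ioc]
  rw [lintegral_lintegral_swap hm.aemeasurable, ← lintegral_indicator measurableSet_Ioi]
  refine lintegral_congr fun z => ?_
  by_cases hz : 0 < z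
  · have : (fun v => (Set.Ioc 0 v).indicator g z) = (Set.Ici z).indicator fun _ => g z := by
      ext v; simp [Set.indicator, hz]
    simp only [Set.indicator_of_mem (Set.mem_Ioi.2 hz)]
    rw [this, lintegral_indicator_const measurableSet_Ici, law_Ici]
  · simp [Set.indicator, hz]

/-- The density of the law cancels the denominator of the inverse hazard rate, wherever it is
positive. -/
theorem lintegral_mul_invHazard {g : ℝ → ℝ≥0∞} (hg : Measurable g) :
    ∫⁻ z, g z * ENNReal.ofReal (F.invHazard z) ∂F.law
      = ∫⁻ z in {v | 0 < F.pdf v}, g z * ENNReal.ofReal (1 - cdf F.law z) := by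
  rw [lintegral_law (g := fun z => g z * ENNReal.ofReal (F.invHazard z)) _
    (hg.mul F.measurable_invHazard.ennreal_ofReal), ← lintegral_indicator F.measurableSet_support]
  refine lintegral_congr fun z => ?_
  by_cases hz : 0 < F.pdf z
  · rw [Set.indicator_of_mem (by exact hz), mul_left_comm,
      ← ENNReal.ofReal_mul (F.pdf_nonneg z), invHazard, mul_div_cancel₀ _ hz.ne']
  · rw [Set.indicator_of_notMem (by exact hz),
      ENNReal.ofReal_of_nonpos (not_lt.1 hz), zero_mul]

/-- The rent integrates the tail over all of `(0, ∞)`, the left side only over the support. This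
direction needs no regularity and yields the upper bound on payments. -/
theorem lintegral_mul_invHazard_le {g : ℝ → ℝ≥0∞} (hg : Measurable g) :
    ∫⁻ z, g z * ENNReal.ofReal (F.invHazard z) ∂F.law
      ≤ ∫⁻ v, (∫⁻ z in Set.Ioc 0 v, g z) ∂F.law := by
  rw [lintegral_rent hg, lintegral_mul_invHazard hg, setLIntegral_congr Ioi_ae_eq_Ici]
  exact lintegral_mono_set fun v hv => F.nonneg_of_pdf_pos hv

/-- Off the support nothing is lost: above it the tail vanishes, and below it `g` does. -/
theorem Regular.lintegral_mul_invHazard_eq (h : F.Regular) {g : ℝ → ℝ≥0∞} (hg : Measurable g)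
    (h0 : ∀ z ∉ F.reached, g z = 0) :
    ∫⁻ z, g z * ENNReal.ofReal (F.invHazard z) ∂F.law
      = ∫⁻ v, (∫⁻ z in Set.Ioc 0 v, g z) ∂F.law := by
  rw [lintegral_rent hg, lintegral_mul_invHazard hg, setLIntegral_congr Ioi_ae_eq_Ici,
    ← lintegral_indicator F.measurableSet_support, ← lintegral_indicator measurableSet_Ici]
  refine lintegral_congr fun z => ?_
  by_cases hz : 0 < F.pdf z
  · rw [Set.indicator_of_mem (by exact hz),
      Set.indicator_of_mem (Set.mem_Ici.2 (F.nonneg_of_pdf_pos hz))]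
  · rw [Set.indicator_of_notMem (by exact hz)]
    by_cases hr : z ∈ F.reached
    · simp [Set.indicator, ← law_Ioi, h.law_Ioi_eq_zero hr hz]
    · simp [Set.indicator, h0 z hr]

end ValueDistribution

/-- Resampling one coordinate does not change an expectation under a product measure. -/
theorem lintegral_resample {n : ℕ} (M : AdMDP n) (i : Fin n) {g : (Fin n → ℝ) → ℝ≥0∞}
    (hg : Measurable g) :
    ∫⁻ v, ∫⁻ y, g (Function.update v i y) ∂(M.dist i).law ∂M.valueLaw
      = ∫⁻ v, g v ∂M.valueLaw := by
  unfold AdMDP.valueLaw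
  have h1 : (fun v => ∫⁻ y, g (Function.update v i y) ∂(M.dist i).law)
      = lmarginal (fun i => (M.dist i).law) {i} g :=
    (lmarginal_singleton (μ := fun i => (M.dist i).law) g i).symm
  have hm : Measurable (lmarginal (fun i => (M.dist i).law) {i} g) := hg.lmarginal _
  rw [h1]
  refine lintegral_eq_of_lmarginal_eq {i} hm hg ?_
  rw [lmarginal_singleton]
  ext x
  simp [lmarginal_update_of_mem _ (Finset.mem_singleton_self i)]

/-! ### The envelope inequality for one bidder -/

section Envelope

variable {x p : ℝ → ℝ}

theorem monotoneOn_of_incentive_compatible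
    (hic : ∀ v, 0 ≤ v → ∀ b, 0 ≤ b → v * x b - p b ≤ v * x v - p v) :
    MonotoneOn x (Set.Ici 0) := by
  intro a ha b hb hab
  rcases hab.eq_or_lt with rfl | hab
  · exact le_rfl
  have h1 := hic a ha b hb
  have h2 := hic b hb a ha
  by_contra! h
  nlinarith [mul_pos (sub_pos.2 hab) (sub_pos.2 h)]

theorem MonotoneOn.intervalIntegrable_of_nonneg (hx : MonotoneOn x (Set.Ici 0)) {a b : ℝ}
    (ha : 0 ≤ a) (hb : 0 ≤ b) : IntervalIntegrable x volume a b :=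
  MonotoneOn.intervalIntegrable
    (hx.mono fun _ hz => (le_inf ha hb : (0 : ℝ) ≤ a ⊓ b).trans (Set.mem_uIcc.1 hz |>.elim
      (fun h => inf_le_left.trans h.1) (fun h => inf_le_right.trans h.1)))

/-- The envelope inequality: a truthful bidder's utility is at least the information rent. -/
theorem envelope_le (hx0 : ∀ b, 0 ≤ b → 0 ≤ x b) (hx1 : ∀ b, 0 ≤ b → x b ≤ 1)
    (hic : ∀ v, 0 ≤ v → ∀ b, 0 ≤ b → v * x b - p b ≤ v * x v - p v) (hir : p 0 ≤ 0)
    {v : ℝ} (hv : 0 ≤ v) : p v + ∫ z in (0)..v, x z ≤ v * x v := by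
  have hmono := monotoneOn_of_incentive_compatible hic
  -- Riemann sums: on each step of length `δ` the integral is at most `δ` times the right-end
  -- allocation, the incentive constraint at the left end supplies the left-end allocation, and the
  -- errors telescope.
  have key : ∀ δ : ℝ, 0 ≤ δ → ∀ k : ℕ, ∫ z in (0)..(k * δ), x z
      ≤ (k * δ * x (k * δ) - p (k * δ)) + p 0 + δ * (x (k * δ) - x 0) := by
    intro δ hδ k
    induction k with
    | zero => simp
    | succ k ih =>
      have ha : 0 ≤ k * δ := by positivity
      have hb : 0 ≤ (k + 1 : ℕ) * δ := by positivity
      have hab : k * δ ≤ (k + 1 : ℕ) * δ := by push_cast; linarith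
      have hint : ∫ z in (k * δ)..((k + 1 : ℕ) * δ), x z
          ≤ ∫ _ in (k * δ)..((k + 1 : ℕ) * δ), x ((k + 1 : ℕ) * δ) :=
        intervalIntegral.integral_mono_on hab (hmono.intervalIntegrable_of_nonneg ha hb)
          intervalIntegrable_const fun z hz => hmono (ha.trans hz.1) hb hz.2
      rw [intervalIntegral.integral_const, smul_eq_mul] at hint
      rw [← intervalIntegral.integral_add_adjacent_intervals
        (hmono.intervalIntegrable_of_nonneg le_rfl ha) (hmono.intervalIntegrable_of_nonneg ha hb)]
      have := hic _ hb _ ha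
      push_cast at *
      nlinarith
  have hlim : ∀ N : ℕ, ∫ z in (0)..v, x z ≤ v * x v - p v + v * (1 / ((N : ℝ) + 1)) := by
    intro N
    have hN : ((N + 1 : ℕ) : ℝ) * (v / (N + 1 : ℕ)) = v := by
      field_simp
    have := key (v / (N + 1 : ℕ)) (by positivity) (N + 1)
    rw [hN] at this
    have h3 : v / (N + 1 : ℕ) * (x v - x 0) ≤ v / (N + 1 : ℕ) * 1 :=
      mul_le_mul_of_nonneg_left (by linarith [hx0 0 le_rfl, hx1 v hv]) (by positivity)
    have h4 : v / (N + 1 : ℕ) * 1 = v * (1 / ((N : ℝ) + 1)) := by push_cast; ring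
    linarith
  have : Filter.Tendsto (fun N : ℕ => v * x v - p v + v * (1 / ((N : ℝ) + 1))) Filter.atTop
      (nhds (v * x v - p v + v * 0)) :=
    (tendsto_one_div_add_atTop_nhds_zero_nat.const_mul v).const_add _
  have := ge_of_tendsto' this hlim
  linarith

/-- The subgradient inequality for the convex function with derivative `x`; it is exactly incentive
compatibility of the envelope payments. -/
theorem MonotoneOn.mul_sub_le_integral_sub (hx : MonotoneOn x (Set.Ici 0)) {v b : ℝ}
    (hv : 0 ≤ v) (hb : 0 ≤ b) :
    x b * (v - b) ≤ (∫ z in (0)..v, x z) - ∫ z in (0)..b, x z := by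
  rw [intervalIntegral.integral_interval_sub_left (hx.intervalIntegrable_of_nonneg le_rfl hv)
    (hx.intervalIntegrable_of_nonneg le_rfl hb)]
  rcases le_total b v with h | h
  · have := intervalIntegral.integral_mono_on h intervalIntegrable_const
      (hx.intervalIntegrable_of_nonneg hb hv) fun z hz => hx hb (hb.trans hz.1) hz.1
    rw [intervalIntegral.integral_const, smul_eq_mul] at this
    linarith
  · have := intervalIntegral.integral_mono_on h (hx.intervalIntegrable_of_nonneg hv hb)
      intervalIntegrable_const fun z hz => hx (hv.trans hz.1) hb hz.2
    rw [intervalIntegral.integral_const, smul_eq_mul] at this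
    rw [intervalIntegral.integral_symm]
    linarith

theorem MonotoneOn.lintegral_Ioc_eq (hx : MonotoneOn x (Set.Ici 0)) (hx0 : ∀ b, 0 ≤ b → 0 ≤ x b)
    {v : ℝ} (hv : 0 ≤ v) :
    ∫⁻ z in Set.Ioc 0 v, ENNReal.ofReal (x z) = ENNReal.ofReal (∫ z in (0)..v, x z) := by
  rw [intervalIntegral.integral_of_le hv, ofReal_integral_eq_lintegral_ofReal
    ((intervalIntegrable_iff_integrableOn_Ioc_of_le hv).1
      (hx.intervalIntegrable_of_nonneg le_rfl hv))]
  exact (ae_restrict_iff' measurableSet_Ioc).2 (.of_forall fun z hz => hx0 z hz.1.le)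

end Envelope

/-! ### Information rents under the product law -/

section Rent

variable {n : ℕ} {M : AdMDP n} {i : Fin n}

theorem measurable_rent {α : Type*} [MeasurableSpace α] {x : α → ℝ → ℝ≥0∞} {t : α → ℝ}
    (hx : Measurable (Function.uncurry x)) (ht : Measurable t) :
    Measurable fun a => ∫⁻ z in Set.Ioc 0 (t a), x a z := by
  simp_rw [← lintegral_indicator measurableSet_Ioc]
  refine Measurable.lintegral_prod_right' (f := fun q : α × ℝ =>
    (Set.Ioc (0 : ℝ) (t q.1)).indicator (fun z => x q.1 z) q.2) ?_
  have : (fun q : α × ℝ => (Set.Ioc (0 : ℝ) (t q.1)).indicator (fun z => x q.1 z) q.2)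
      = {q : α × ℝ | 0 < q.2 ∧ q.2 ≤ t q.1}.indicator (Function.uncurry x) := by
    ext q; simp [Set.indicator, Set.mem_Ioc, Function.uncurry]
  rw [this]
  exact hx.indicator ((measurableSet_lt measurable_const measurable_snd).inter
    (measurableSet_le measurable_snd (ht.comp measurable_fst)))

theorem measurable_update_uncurry (i : Fin n) :
    Measurable (Function.uncurry fun (v : Fin n → ℝ) z => Function.update v i z) := by
  refine measurable_pi_lambda _ fun j => ?_
  rcases eq_or_ne j i with rfl | hj
  · simpa [Function.uncurry] using measurable_snd
  · simp only [Function.uncurry, ne_eq, hj, not_false_eq_true, Function.update_of_ne]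
    exact (measurable_pi_apply j).comp measurable_fst

/-- Resampling coordinate `i` on both sides reduces this to the one-dimensional inequality with the
other values fixed. -/
theorem lintegral_invHazard_le {x : (Fin n → ℝ) → ℝ≥0∞} (hx : Measurable x) :
    ∫⁻ v, x v * ENNReal.ofReal ((M.dist i).invHazard (v i)) ∂M.valueLaw
      ≤ ∫⁻ v, (∫⁻ z in Set.Ioc 0 (v i), x (Function.update v i z)) ∂M.valueLaw := by
  have hu := measurable_update_uncurry i
  rw [← lintegral_resample M i (g := fun v => x v * ENNReal.ofReal ((M.dist i).invHazard (v i)))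
      (hx.mul ((M.dist i).measurable_invHazard.comp (measurable_pi_apply i)).ennreal_ofReal),
    ← lintegral_resample M i (g := fun v => ∫⁻ z in Set.Ioc 0 (v i), x (Function.update v i z))
      (measurable_rent (hx.comp hu) (measurable_pi_apply i))]
  refine lintegral_mono fun v => ?_
  simp only [Function.update_self, Function.update_idem]
  exact ValueDistribution.lintegral_mul_invHazard_le (g := fun z => x (Function.update v i z))
    (hx.comp (hu.comp measurable_prodMk_left))

theorem lintegral_invHazard_eq (hreg : (M.dist i).Regular) {x : (Fin n → ℝ) → ℝ≥0∞}
    (hx : Measurable x) (h0 : ∀ v, v i ∉ (M.dist i).reached → x v = 0) :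
    ∫⁻ v, x v * ENNReal.ofReal ((M.dist i).invHazard (v i)) ∂M.valueLaw
      = ∫⁻ v, (∫⁻ z in Set.Ioc 0 (v i), x (Function.update v i z)) ∂M.valueLaw := by
  have hu := measurable_update_uncurry i
  rw [← lintegral_resample M i (g := fun v => x v * ENNReal.ofReal ((M.dist i).invHazard (v i)))
      (hx.mul ((M.dist i).measurable_invHazard.comp (measurable_pi_apply i)).ennreal_ofReal),
    ← lintegral_resample M i (g := fun v => ∫⁻ z in Set.Ioc 0 (v i), x (Function.update v i z))
      (measurable_rent (hx.comp hu) (measurable_pi_apply i))]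
  refine lintegral_congr fun v => ?_
  simp only [Function.update_self, Function.update_idem]
  exact hreg.lintegral_mul_invHazard_eq (g := fun z => x (Function.update v i z))
    (hx.comp (hu.comp measurable_prodMk_left)) fun z hz => h0 _ (by simpa using hz)

end Rent

/-! ### Pointwise consequences of incentive compatibility -/

namespace Mechanism

variable {n : ℕ} (a : Mechanism n)

theorem alloc_le_one {b : Fin n → ℝ} (hb : 0 ≤ b) (i : Fin n) : a.alloc b i ≤ 1 :=
  (Finset.single_le_sum (fun j _ => a.alloc_nonneg b hb j) (Finset.mem_univ i)).trans
    (a.sum_alloc_le_one b hb)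

theorem pay_le {b : Fin n → ℝ} (hb : 0 ≤ b) (i : Fin n) : a.pay b i ≤ b i * a.alloc b i := by
  linarith [a.individually_rational b hb i]

theorem update_nonneg {v : Fin n → ℝ} (hv : 0 ≤ v) {i : Fin n} {z : ℝ} (hz : 0 ≤ z) :
    0 ≤ Function.update v i z := by
  intro j
  rcases eq_or_ne j i with rfl | hj
  · simpa using hz
  · simpa [hj] using hv j

theorem incentive_compatible_update {v : Fin n → ℝ} (hv : 0 ≤ v) (i : Fin n) (w : ℝ) (hw : 0 ≤ w)
    (b : ℝ) (hb : 0 ≤ b) :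
    w * a.alloc (Function.update v i b) i - a.pay (Function.update v i b) i
      ≤ w * a.alloc (Function.update v i w) i - a.pay (Function.update v i w) i := by
  simpa using a.incentive_compatible (Function.update v i w) (update_nonneg hv hw) i b hb

/-- The envelope inequality in `ℝ≥0∞`, so that it can be integrated before the hazard-rate term is
known to be integrable. -/
theorem pay_add_rent_le {v : Fin n → ℝ} (hv : 0 ≤ v) (i : Fin n) :
    ENNReal.ofReal (a.pay v i)
        + ∫⁻ z in Set.Ioc 0 (v i), ENNReal.ofReal (a.alloc (Function.update v i z) i)
      ≤ ENNReal.ofReal (v i * a.alloc v i) := by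
  have hic := a.incentive_compatible_update hv i
  have h0 : ∀ b, 0 ≤ b → 0 ≤ a.alloc (Function.update v i b) i := fun b hb =>
    a.alloc_nonneg _ (update_nonneg hv hb) i
  have hir := a.pay_le (update_nonneg hv (le_refl (0 : ℝ)) (i := i)) i
  have h := envelope_le h0 (fun b hb => a.alloc_le_one (update_nonneg hv hb) i) hic
    (by simpa using hir) (hv i)
  rw [(monotoneOn_of_incentive_compatible hic).lintegral_Ioc_eq h0 (hv i),
    ← ENNReal.ofReal_add (a.pay_nonneg v hv i)]
  · exact ENNReal.ofReal_le_ofReal (by simpa using h)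
  · exact intervalIntegral.integral_nonneg (hv i) fun z hz => h0 z hz.1

end Mechanism

/-! ### Myerson's theorem: expected payments and virtual surplus -/

namespace AdMDP

variable {n : ℕ} {M : AdMDP n}

theorem measurePreserving_eval (M : AdMDP n) (i : Fin n) :
    MeasurePreserving (fun v : Fin n → ℝ => v i) M.valueLaw (M.dist i).law :=
  MeasureTheory.measurePreserving_eval (fun i => (M.dist i).law) i

theorem ae_of_forall_ae {p : Fin n → ℝ → Prop} (h : ∀ i, ∀ᵐ y ∂(M.dist i).law, p i y) :
    ∀ᵐ v ∂M.valueLaw, ∀ i, p i (v i) :=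
  ae_all_iff.2 fun i => (M.measurePreserving_eval i).quasiMeasurePreserving.ae (h i)

theorem ae_nonneg (M : AdMDP n) : ∀ᵐ v ∂M.valueLaw, 0 ≤ v :=
  M.ae_of_forall_ae fun i => (M.dist i).ae_nonneg

theorem ae_pdf_pos (M : AdMDP n) : ∀ᵐ v ∂M.valueLaw, ∀ i, 0 < (M.dist i).pdf (v i) :=
  M.ae_of_forall_ae fun i => (M.dist i).ae_pdf_pos

theorem integrable_value (M : AdMDP n) (i : Fin n) : Integrable (fun v => v i) M.valueLaw :=
  (M.measurePreserving_eval i).integrable_comp_of_integrable (M.dist i).integrable_id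

variable (a : Mechanism n) (i : Fin n)

theorem measurable_alloc_apply : Measurable fun v => a.alloc v i :=
  (measurable_pi_apply i).comp a.measurable_alloc

theorem measurable_pay_apply : Measurable fun v => a.pay v i :=
  (measurable_pi_apply i).comp a.measurable_pay

theorem integrable_alloc : Integrable (fun v => a.alloc v i) M.valueLaw := by
  refine (integrable_const (1 : ℝ)).mono' (measurable_alloc_apply a i).aestronglyMeasurable ?_
  filter_upwards [M.ae_nonneg] with v hv
  rw [Real.norm_of_nonneg (a.alloc_nonneg v hv i)]
  exact a.alloc_le_one hv i

theorem integrable_pay : Integrable (fun v => a.pay v i) M.valueLaw := by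
  refine (M.integrable_value i).mono' (measurable_pay_apply a i).aestronglyMeasurable ?_
  filter_upwards [M.ae_nonneg] with v hv
  rw [Real.norm_of_nonneg (a.pay_nonneg v hv i)]
  exact (a.pay_le hv i).trans (mul_le_of_le_one_right (hv i) (a.alloc_le_one hv i))

theorem integrable_value_mul_alloc : Integrable (fun v => v i * a.alloc v i) M.valueLaw := by
  refine (M.integrable_value i).mono'
    ((measurable_pi_apply i).mul (measurable_alloc_apply a i)).aestronglyMeasurable ?_
  filter_upwards [M.ae_nonneg] with v hv
  rw [Real.norm_of_nonneg (mul_nonneg (hv i) (a.alloc_nonneg v hv i))]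
  exact mul_le_of_le_one_right (hv i) (a.alloc_le_one hv i)

variable (M)

/-- The ex ante probability that bidder `i` wins in mechanism `a`. -/
noncomputable def winProb : ℝ := ∫ v, a.alloc v i ∂M.valueLaw

/-- The expected payment of bidder `i` in mechanism `a`. -/
noncomputable def meanPay : ℝ := ∫ v, a.pay v i ∂M.valueLaw

/-- The expected virtual surplus of bidder `i` in mechanism `a`. -/
noncomputable def virtualSurplus : ℝ :=
  ∫ v, (M.dist i).extVirtualValue (v i) * a.alloc v i ∂M.valueLaw

variable {M}

theorem lintegral_alloc_mul_invHazard_le :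
    ∫⁻ v, ENNReal.ofReal (a.pay v i) ∂M.valueLaw
        + ∫⁻ v, ENNReal.ofReal (a.alloc v i) * ENNReal.ofReal ((M.dist i).invHazard (v i))
          ∂M.valueLaw
      ≤ ∫⁻ v, ENNReal.ofReal (v i * a.alloc v i) ∂M.valueLaw := by
  have hx := (measurable_alloc_apply a i).ennreal_ofReal
  refine (add_le_add_right (lintegral_invHazard_le hx) _).trans ?_
  rw [← lintegral_add_left (measurable_pay_apply a i).ennreal_ofReal]
  refine lintegral_mono_ae ?_
  filter_upwards [M.ae_nonneg] with v hv
  exact a.pay_add_rent_le hv i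

/-- Finiteness comes from the rent inequality: the expected rent is at most the expected value won,
which is finite. -/
theorem integrable_invHazard_mul_alloc :
    Integrable (fun v => (M.dist i).invHazard (v i) * a.alloc v i) M.valueLaw := by
  have hm := ((M.dist i).measurable_invHazard.comp (measurable_pi_apply i)).mul
    (measurable_alloc_apply a i)
  refine ⟨hm.aestronglyMeasurable, ?_⟩
  rw [hasFiniteIntegral_iff_ofReal]
  · refine lt_of_le_of_lt ?_ (integrable_value_mul_alloc a i (M := M)).lintegral_lt_top
    refine le_trans (le_of_eq ?_) (le_add_self.trans (lintegral_alloc_mul_invHazard_le a i))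
    refine lintegral_congr fun v => ?_
    rw [ENNReal.ofReal_mul ((M.dist i).invHazard_nonneg _), mul_comm]
  · filter_upwards [M.ae_nonneg] with v hv
    exact mul_nonneg ((M.dist i).invHazard_nonneg _) (a.alloc_nonneg v hv i)

theorem ae_extVirtualValue_mul_alloc : (fun v => (M.dist i).extVirtualValue (v i) * a.alloc v i)
    =ᵐ[M.valueLaw] fun v => v i * a.alloc v i - (M.dist i).invHazard (v i) * a.alloc v i := by
  filter_upwards [M.ae_pdf_pos] with v hv
  rw [ValueDistribution.extVirtualValue, if_pos (hv i), ValueDistribution.virtualValue_eq, sub_mul]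

theorem integrable_extVirtualValue_mul_alloc :
    Integrable (fun v => (M.dist i).extVirtualValue (v i) * a.alloc v i) M.valueLaw :=
  ((integrable_value_mul_alloc a i).sub (integrable_invHazard_mul_alloc a i)).congr
    (ae_extVirtualValue_mul_alloc a i).symm

theorem virtualSurplus_eq : M.virtualSurplus a i = ∫ v, v i * a.alloc v i ∂M.valueLaw
    - ∫ v, (M.dist i).invHazard (v i) * a.alloc v i ∂M.valueLaw := by
  rw [virtualSurplus, integral_congr_ae (ae_extVirtualValue_mul_alloc a i),
    integral_sub (integrable_value_mul_alloc a i) (integrable_invHazard_mul_alloc a i)]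

theorem ofReal_integral_invHazard :
    ENNReal.ofReal (∫ v, (M.dist i).invHazard (v i) * a.alloc v i ∂M.valueLaw)
      = ∫⁻ v, ENNReal.ofReal (a.alloc v i) * ENNReal.ofReal ((M.dist i).invHazard (v i))
          ∂M.valueLaw := by
  rw [ofReal_integral_eq_lintegral_ofReal (integrable_invHazard_mul_alloc a i)]
  · refine lintegral_congr fun v => ?_
    rw [ENNReal.ofReal_mul ((M.dist i).invHazard_nonneg _), mul_comm]
  · filter_upwards [M.ae_nonneg] with v hv
    exact mul_nonneg ((M.dist i).invHazard_nonneg _) (a.alloc_nonneg v hv i)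

theorem integral_invHazard_nonneg :
    0 ≤ ∫ v, (M.dist i).invHazard (v i) * a.alloc v i ∂M.valueLaw := by
  refine integral_nonneg_of_ae ?_
  filter_upwards [M.ae_nonneg] with v hv
  exact mul_nonneg ((M.dist i).invHazard_nonneg _) (a.alloc_nonneg v hv i)

theorem ae_pay_nonneg : 0 ≤ᵐ[M.valueLaw] fun v => a.pay v i := by
  filter_upwards [M.ae_nonneg] with v hv using a.pay_nonneg v hv i

theorem ae_alloc_nonneg : 0 ≤ᵐ[M.valueLaw] fun v => a.alloc v i := by
  filter_upwards [M.ae_nonneg] with v hv using a.alloc_nonneg v hv i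

theorem ae_value_mul_alloc_nonneg : 0 ≤ᵐ[M.valueLaw] fun v => v i * a.alloc v i := by
  filter_upwards [M.ae_nonneg] with v hv using mul_nonneg (hv i) (a.alloc_nonneg v hv i)

theorem meanPay_nonneg : 0 ≤ M.meanPay a i := integral_nonneg_of_ae (ae_pay_nonneg a i)

theorem winProb_nonneg : 0 ≤ M.winProb a i := integral_nonneg_of_ae (ae_alloc_nonneg a i)

/-- Expected payments are at most the expected virtual surplus (Myerson). -/
theorem meanPay_le_virtualSurplus : M.meanPay a i ≤ M.virtualSurplus a i := by
  have h := lintegral_alloc_mul_invHazard_le a i (M := M)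
  rw [← ofReal_integral_invHazard, ← ofReal_integral_eq_lintegral_ofReal (integrable_pay a i)
    (ae_pay_nonneg a i), ← ofReal_integral_eq_lintegral_ofReal (integrable_value_mul_alloc a i)
    (ae_value_mul_alloc_nonneg a i), ← ENNReal.ofReal_add (integral_nonneg_of_ae (ae_pay_nonneg a i))
    (integral_invHazard_nonneg a i), ENNReal.ofReal_le_ofReal_iff
    (integral_nonneg_of_ae (ae_value_mul_alloc_nonneg a i))] at h
  rw [virtualSurplus_eq, meanPay]
  linarith

/-- Myerson's identity for mechanisms with the envelope payments that never allocate to a bidder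
below the support. -/
theorem meanPay_eq_virtualSurplus (hreg : (M.dist i).Regular)
    (hpay : ∀ v, 0 ≤ v → a.pay v i
      = v i * a.alloc v i - ∫ z in (0)..(v i), a.alloc (Function.update v i z) i)
    (h0 : ∀ v, v i ∉ (M.dist i).reached → a.alloc v i = 0) :
    M.meanPay a i = M.virtualSurplus a i := by
  have h : ∫⁻ v, ENNReal.ofReal (a.pay v i) ∂M.valueLaw
        + ∫⁻ v, ENNReal.ofReal (a.alloc v i) * ENNReal.ofReal ((M.dist i).invHazard (v i))
          ∂M.valueLaw
      = ∫⁻ v, ENNReal.ofReal (v i * a.alloc v i) ∂M.valueLaw := by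
    rw [lintegral_invHazard_eq hreg (measurable_alloc_apply a i).ennreal_ofReal
      (fun v hv => by rw [h0 v hv, ENNReal.ofReal_zero]),
      ← lintegral_add_left (measurable_pay_apply a i).ennreal_ofReal]
    refine lintegral_congr_ae ?_
    filter_upwards [M.ae_nonneg] with v hv
    have h1 : ∀ b, 0 ≤ b → 0 ≤ a.alloc (Function.update v i b) i := fun b hb =>
      a.alloc_nonneg _ (Mechanism.update_nonneg hv hb) i
    rw [(monotoneOn_of_incentive_compatible
      (a.incentive_compatible_update hv i)).lintegral_Ioc_eq h1 (hv i),
      ← ENNReal.ofReal_add (a.pay_nonneg v hv i)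
        (intervalIntegral.integral_nonneg (show (0 : ℝ) ≤ v i from hv i) fun z hz => h1 z hz.1), hpay v hv,
      sub_add_cancel]
  rw [← ofReal_integral_invHazard, ← ofReal_integral_eq_lintegral_ofReal (integrable_pay a i)
    (ae_pay_nonneg a i), ← ofReal_integral_eq_lintegral_ofReal (integrable_value_mul_alloc a i)
    (ae_value_mul_alloc_nonneg a i), ← ENNReal.ofReal_add (integral_nonneg_of_ae (ae_pay_nonneg a i))
    (integral_invHazard_nonneg a i), ENNReal.ofReal_eq_ofReal_iff
    (add_nonneg (integral_nonneg_of_ae (ae_pay_nonneg a i)) (integral_invHazard_nonneg a i))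
    (integral_nonneg_of_ae (ae_value_mul_alloc_nonneg a i))] at h
  rw [virtualSurplus_eq, meanPay]
  linarith

theorem showProb_some : M.showProb a (some i) = ENNReal.ofReal (M.winProb a i) :=
  (ofReal_integral_eq_lintegral_ofReal (integrable_alloc a i) (ae_alloc_nonneg a i)).symm

theorem sum_winProb_le_one : ∑ i, M.winProb a i ≤ 1 := by
  unfold winProb
  rw [← integral_finsetSum _ fun i _ => integrable_alloc a i]
  calc _ ≤ ∫ _, (1 : ℝ) ∂M.valueLaw := by
        refine integral_mono_ae (integrable_finsetSum _ fun i _ => integrable_alloc a i)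
          (integrable_const _) ?_
        filter_upwards [M.ae_nonneg] with v hv using a.sum_alloc_le_one v hv
    _ = 1 := by simp

theorem showProb_none : M.showProb a none = ENNReal.ofReal (1 - ∑ i, M.winProb a i) := by
  change ∫⁻ v, ENNReal.ofReal (1 - ∑ i, a.alloc v i) ∂M.valueLaw = _
  unfold winProb
  rw [← integral_finsetSum _ fun i _ => integrable_alloc a i]
  have h := integrable_finsetSum (μ := M.valueLaw) Finset.univ fun i _ => integrable_alloc a i
  rw [← ofReal_integral_eq_lintegral_ofReal (f := fun v => 1 - ∑ i, a.alloc v i)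
    ((integrable_const _).sub h), integral_sub (integrable_const _) h]
  · simp
  · filter_upwards [M.ae_nonneg] with v hv
    simpa using a.sum_alloc_le_one v hv

theorem expectedPayment_eq : M.expectedPayment a = ENNReal.ofReal (∑ i, M.meanPay a i) := by
  unfold expectedPayment meanPay
  rw [← integral_finsetSum _ fun i _ => integrable_pay a i,
    ofReal_integral_eq_lintegral_ofReal (integrable_finsetSum _ fun i _ => integrable_pay a i)]
  filter_upwards [M.ae_nonneg] with v hv
  exact Finset.sum_nonneg fun i _ => a.pay_nonneg v hv i

theorem sum_showProb : ∑ o, M.showProb a o = 1 := by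
  rw [Fintype.sum_option, showProb_none]
  simp_rw [showProb_some]
  rw [← ENNReal.ofReal_sum_of_nonneg fun i _ => winProb_nonneg a i,
    ← ENNReal.ofReal_add (by linarith [sum_winProb_le_one a (M := M)])
      (Finset.sum_nonneg fun i _ => winProb_nonneg a i)]
  simp

/-- A bound on the expected revenue of every mechanism. -/
theorem expectedPayment_le :
    M.expectedPayment a ≤ ENNReal.ofReal (∑ i, ∫ v, v i ∂M.valueLaw) := by
  rw [expectedPayment_eq]
  refine ENNReal.ofReal_le_ofReal (Finset.sum_le_sum fun i _ => ?_)
  refine integral_mono_ae (integrable_pay a i) (M.integrable_value i) ?_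
  filter_upwards [M.ae_nonneg] with v hv
  exact (a.pay_le hv i).trans (mul_le_of_le_one_right (hv i) (a.alloc_le_one hv i))

end AdMDP

/-! ### Score auctions maximize revenue plus continuation weights -/

/-- The mechanism with a given monotone allocation rule and the envelope payments. -/
noncomputable def Mechanism.ofMonotone {n : ℕ} (x : (Fin n → ℝ) → Fin n → ℝ) (hx : Measurable x)
    (h0 : ∀ b i, 0 ≤ x b i) (h1 : ∀ b, ∑ i, x b i ≤ 1)
    (hmono : ∀ b i, Monotone fun z => x (Function.update b i z) i) : Mechanism n where
  alloc := x
  pay b i := b i * x b i - ∫ z in Set.Ioc 0 (b i), x (Function.update b i z) i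
  measurable_alloc := hx
  measurable_pay := by
    refine measurable_pi_lambda _ fun i => ?_
    have hxi : Measurable fun b => x b i := (measurable_pi_apply i).comp hx
    refine ((measurable_pi_apply i).mul hxi).sub ?_
    simp_rw [← integral_indicator measurableSet_Ioc]
    refine (StronglyMeasurable.integral_prod_right' (f := fun q : (Fin n → ℝ) × ℝ =>
      (Set.Ioc (0 : ℝ) (q.1 i)).indicator (fun z => x (Function.update q.1 i z) i) q.2) ?_).measurable
    refine Measurable.stronglyMeasurable ?_
    have : (fun q : (Fin n → ℝ) × ℝ =>
        (Set.Ioc (0 : ℝ) (q.1 i)).indicator (fun z => x (Function.update q.1 i z) i) q.2)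
        = {q : (Fin n → ℝ) × ℝ | 0 < q.2 ∧ q.2 ≤ q.1 i}.indicator
          fun q => x (Function.update q.1 i q.2) i := by
      ext q; simp [Set.indicator, Set.mem_Ioc]
    rw [this]
    exact (hxi.comp (measurable_update_uncurry i)).indicator
      ((measurableSet_lt measurable_const measurable_snd).inter
      (measurableSet_le measurable_snd ((measurable_pi_apply i).comp measurable_fst)))
  alloc_nonneg b _ i := h0 b i
  sum_alloc_le_one b _ := h1 b
  pay_nonneg b hb i := by
    rw [← intervalIntegral.integral_of_le (show (0 : ℝ) ≤ b i from hb i)]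
    have := ((hmono b i).monotoneOn (Set.Ici 0)).mul_sub_le_integral_sub le_rfl (hb i)
    simp only [Function.update_eq_self, intervalIntegral.integral_same] at this
    linarith
  incentive_compatible v hv i b hb := by
    have := ((hmono v i).monotoneOn (Set.Ici 0)).mul_sub_le_integral_sub (hv i) hb
    simp only [Function.update_self, Function.update_idem]
    rw [← intervalIntegral.integral_of_le (show (0 : ℝ) ≤ v i from hv i), ← intervalIntegral.integral_of_le hb]
    linarith
  individually_rational v hv i := by
    rw [sub_sub_cancel]
    exact integral_nonneg fun z => h0 _ i

namespace AdMDP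

variable {n : ℕ} (M : AdMDP n)

/-- The score of a bid: the extended virtual value, scaled by the click-through rate `c`, plus the
continuation weight of the ad. -/
noncomputable def score (c : ℝ) (w : Fin n → ℝ) (b : Fin n → ℝ) (i : Fin n) : ℝ :=
  c * (M.dist i).extVirtualValue (b i) + w i

/-- The winner is the bidder with the highest non-negative score among those whose bid does not
lie below the support; ties go to the smaller index. -/
def ScoreWins (c : ℝ) (w : Fin n → ℝ) (b : Fin n → ℝ) (i : Fin n) : Prop :=
  b i ∈ (M.dist i).reached ∧ 0 ≤ M.score c w b i ∧
    ∀ j, j ≠ i → b j ∈ (M.dist j).reached →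
      M.score c w b j < M.score c w b i ∨ (M.score c w b j = M.score c w b i ∧ i < j)

open Classical in
/-- The allocation rule of the score auction. -/
noncomputable def scoreAlloc (c : ℝ) (w : Fin n → ℝ) (b : Fin n → ℝ) (i : Fin n) : ℝ :=
  if M.ScoreWins c w b i then 1 else 0

variable {M}

theorem ScoreWins.unique {c : ℝ} {w b : Fin n → ℝ} {i j : Fin n} (hi : M.ScoreWins c w b i)
    (hj : M.ScoreWins c w b j) : i = j := by
  by_contra h
  rcases hi.2.2 j (Ne.symm h) hj.1 with h1 | h1 <;> rcases hj.2.2 i h hi.1 with h2 | h2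
  · exact lt_asymm h1 h2
  · exact h1.ne' h2.1
  · exact h2.ne' h1.1
  · exact lt_asymm h1.2 h2.2

theorem scoreAlloc_nonneg (c : ℝ) (w b : Fin n → ℝ) (i : Fin n) : 0 ≤ M.scoreAlloc c w b i := by
  unfold scoreAlloc; split_ifs <;> simp

theorem sum_mul_scoreAlloc {c : ℝ} {w b : Fin n → ℝ} {i : Fin n} (hi : M.ScoreWins c w b i)
    (s : Fin n → ℝ) : ∑ j, s j * M.scoreAlloc c w b j = s i := by
  rw [Finset.sum_eq_single i]
  · simp [scoreAlloc, hi]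
  · intro j _ hj
    rw [scoreAlloc, if_neg fun h => hj (h.unique hi), mul_zero]
  · simp

theorem sum_scoreAlloc_le_one (c : ℝ) (w b : Fin n → ℝ) : ∑ i, M.scoreAlloc c w b i ≤ 1 := by
  by_cases h : ∃ i, M.ScoreWins c w b i
  · obtain ⟨i, hi⟩ := h
    simpa using (sum_mul_scoreAlloc hi fun _ => 1).le
  · push Not at h
    simp [scoreAlloc, h]

/-- A higher bid stays in `reached`, does not lower the bidder's own score and leaves the other
scores alone. -/
theorem monotone_scoreAlloc (hreg : ∀ i, (M.dist i).Regular) {c : ℝ} (hc : 0 ≤ c)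
    (w b : Fin n → ℝ) (i : Fin n) :
    Monotone fun z => M.scoreAlloc c w (Function.update b i z) i := by
  intro z z' hz
  have key : M.ScoreWins c w (Function.update b i z) i →
      M.ScoreWins c w (Function.update b i z') i := by
    rintro ⟨h1, h2, h3⟩
    rw [Function.update_self] at h1
    have h1' := (M.dist i).isUpperSet_reached hz h1
    have hle : M.score c w (Function.update b i z) i ≤ M.score c w (Function.update b i z') i := by
      simp only [score, Function.update_self]
      linarith [mul_le_mul_of_nonneg_left
        ((hreg i).monotoneOn_extVirtualValue h1 h1' hz) hc]
    refine ⟨by simpa using h1', h2.trans hle, fun j hj hjr => ?_⟩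
    have hs : M.score c w (Function.update b i z') j = M.score c w (Function.update b i z) j := by
      simp [score, hj]
    rw [Function.update_of_ne hj] at hjr
    rw [hs]
    rcases h3 j hj (by rwa [Function.update_of_ne hj]) with h | h
    · exact Or.inl (h.trans_le hle)
    · rcases hle.eq_or_lt with h' | h'
      · exact Or.inr ⟨h.1.trans h', h.2⟩
      · exact Or.inl (h.1.trans_lt h')
  simp only [scoreAlloc]
  split_ifs with h h'
  · exact le_rfl
  · exact absurd (key h) h'
  · exact zero_le_one
  · exact le_rfl

theorem measurable_score (i : Fin n) :
    Measurable fun p : (ℝ × (Fin n → ℝ)) × (Fin n → ℝ) => M.score p.1.1 p.1.2 p.2 i :=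
  ((measurable_fst.comp measurable_fst).mul ((M.dist i).measurable_extVirtualValue.comp
    ((measurable_pi_apply i).comp measurable_snd))).add
    ((measurable_pi_apply i).comp (measurable_snd.comp measurable_fst))

theorem measurable_scoreAlloc_apply (i : Fin n) :
    Measurable fun p : (ℝ × (Fin n → ℝ)) × (Fin n → ℝ) => M.scoreAlloc p.1.1 p.1.2 p.2 i := by
  have hr : ∀ j, MeasurableSet
      {p : (ℝ × (Fin n → ℝ)) × (Fin n → ℝ) | p.2 j ∈ (M.dist j).reached} := fun j =>
    ((measurable_pi_apply j).comp measurable_snd) (M.dist j).measurableSet_reached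
  refine Measurable.ite ?_ measurable_const measurable_const
  refine (hr i).inter ((measurableSet_le measurable_const (measurable_score i)).inter ?_)
  refine MeasurableSet.congr (s := ⋂ j, {p : (ℝ × (Fin n → ℝ)) × (Fin n → ℝ) | j ≠ i →
    p.2 j ∈ (M.dist j).reached → M.score p.1.1 p.1.2 p.2 j < M.score p.1.1 p.1.2 p.2 i ∨
      (M.score p.1.1 p.1.2 p.2 j = M.score p.1.1 p.1.2 p.2 i ∧ i < j)}) ?_ ?_
  · refine MeasurableSet.iInter fun j => ?_
    refine (MeasurableSet.const _).imp ((hr j).imp ?_)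
    exact (measurableSet_lt (measurable_score j) (measurable_score i)).union
      ((measurableSet_eq_fun (measurable_score j) (measurable_score i)).inter (.const _))
  · ext p
    rw [Set.mem_iInter]
    rfl

variable (M)

/-- The auction that maximizes `c` times the revenue plus the weights of the ads shown. -/
noncomputable def scoreMech (hreg : ∀ i, (M.dist i).Regular) (c : unitInterval) (w : Fin n → ℝ) :
    Mechanism n :=
  Mechanism.ofMonotone (M.scoreAlloc c w)
    (measurable_pi_lambda _ fun i => (measurable_scoreAlloc_apply i).comp
      (measurable_prodMk_left (x := ((c : ℝ), w))))
    (scoreAlloc_nonneg c w) (sum_scoreAlloc_le_one c w) (monotone_scoreAlloc hreg c.2.1 w)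

variable {M}

/-- This is why the score auction refuses bids below the support: winning there would create rent
that the virtual surplus does not see. -/
theorem meanPay_scoreMech (hreg : ∀ i, (M.dist i).Regular) (c : unitInterval) (w : Fin n → ℝ)
    (i : Fin n) :
    M.meanPay (M.scoreMech hreg c w) i = M.virtualSurplus (M.scoreMech hreg c w) i := by
  refine meanPay_eq_virtualSurplus _ i (hreg i) (fun v hv => ?_) fun v hv => ?_
  · rw [intervalIntegral.integral_of_le (show (0 : ℝ) ≤ v i from hv i)]
    rfl
  · change M.scoreAlloc c w v i = 0
    rw [scoreAlloc, if_neg fun h => hv h.1]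

/-- Weights of total mass at most one cannot average above the positive part of the largest score,
which is what the auction collects. -/
theorem sum_score_mul_le (c : ℝ) (w : Fin n → ℝ) {b : Fin n → ℝ}
    (hb : ∀ i, b i ∈ (M.dist i).reached) {x : Fin n → ℝ} (hx : ∀ i, 0 ≤ x i)
    (hx1 : ∑ i, x i ≤ 1) :
    ∑ i, M.score c w b i * x i ≤ ∑ i, M.score c w b i * M.scoreAlloc c w b i := by
  by_cases h : ∃ i, M.ScoreWins c w b i
  · obtain ⟨i, hi⟩ := h
    rw [sum_mul_scoreAlloc hi]
    calc ∑ j, M.score c w b j * x j ≤ ∑ j, M.score c w b i * x j := by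
          refine Finset.sum_le_sum fun j _ => mul_le_mul_of_nonneg_right ?_ (hx j)
          rcases eq_or_ne j i with rfl | hj
          · exact le_rfl
          · exact (hi.2.2 j hj (hb j)).elim le_of_lt fun h => h.1.le
      _ = M.score c w b i * ∑ j, x j := by rw [Finset.mul_sum]
      _ ≤ M.score c w b i := mul_le_of_le_one_right hi.2.1 hx1
  · have hneg : ∀ i, M.score c w b i < 0 := by
      by_contra! hex
      obtain ⟨i₀, hi₀⟩ := hex
      -- Lexicographic maximum with the index order reversed, to match the tie-breaking rule.
      obtain ⟨i, -, hi⟩ := Finset.exists_max_image Finset.univ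
        (fun i => toLex (M.score c w b i, OrderDual.toDual i)) ⟨i₀, Finset.mem_univ _⟩
      refine h ⟨i, hb i, hi₀.trans ?_, fun j hj _ => ?_⟩
      · exact (Prod.Lex.le_iff.1 (hi i₀ (Finset.mem_univ _))).elim le_of_lt fun h => h.1.le
      · exact (Prod.Lex.le_iff.1 (hi j (Finset.mem_univ _))).imp_right fun h =>
          ⟨h.1, lt_of_le_of_ne (OrderDual.toDual_le_toDual.1 h.2) hj.symm⟩
    push Not at h
    simp only [scoreAlloc, h, if_false, mul_zero, Finset.sum_const_zero]
    exact Finset.sum_nonpos fun i _ => mul_nonpos_of_nonpos_of_nonneg (hneg i).le (hx i)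

theorem sum_virtualSurplus_add (a : Mechanism n) (c : ℝ) (w : Fin n → ℝ) :
    c * ∑ i, M.virtualSurplus a i + ∑ i, w i * M.winProb a i
      = ∫ v, ∑ i, M.score c w v i * a.alloc v i ∂M.valueLaw := by
  have h1 := fun i => (integrable_extVirtualValue_mul_alloc a i (M := M)).const_mul c
  have h2 := fun i => (integrable_alloc a i (M := M)).const_mul (w i)
  have h3 : ∀ i, (fun v => M.score c w v i * a.alloc v i) = fun v =>
      c * ((M.dist i).extVirtualValue (v i) * a.alloc v i) + w i * a.alloc v i := by
    intro i; ext v; rw [score]; ring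
  rw [integral_finsetSum _ fun i _ => by rw [h3]; exact (h1 i).add (h2 i), Finset.mul_sum,
    ← Finset.sum_add_distrib]
  refine Finset.sum_congr rfl fun i _ => ?_
  rw [h3, integral_add (h1 i) (h2 i), integral_const_mul, integral_const_mul]
  rfl

/-- Payments are at most the virtual surplus for every mechanism, with equality for the score
auction, and the score auction maximizes the integrand pointwise. -/
theorem weighted_revenue_le_scoreMech (hreg : ∀ i, (M.dist i).Regular) (a : Mechanism n)
    (c : unitInterval) (w : Fin n → ℝ) :
    c * ∑ i, M.meanPay a i + ∑ i, w i * M.winProb a i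
      ≤ c * ∑ i, M.meanPay (M.scoreMech hreg c w) i
        + ∑ i, w i * M.winProb (M.scoreMech hreg c w) i := by
  simp_rw [meanPay_scoreMech]
  have h1 : c * ∑ i, M.meanPay a i ≤ c * ∑ i, M.virtualSurplus a i :=
    mul_le_mul_of_nonneg_left (Finset.sum_le_sum fun i _ => meanPay_le_virtualSurplus a i) c.2.1
  refine (add_le_add_left h1 _).trans ?_
  rw [sum_virtualSurplus_add, sum_virtualSurplus_add]
  have hint : ∀ a : Mechanism n, Integrable (fun v => ∑ i, M.score c w v i * a.alloc v i)
      M.valueLaw := fun a => integrable_finsetSum _ fun i _ => by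
    have h : (fun v => M.score c w v i * a.alloc v i) = fun v =>
        c * ((M.dist i).extVirtualValue (v i) * a.alloc v i) + w i * a.alloc v i := by
      ext v; rw [score]; ring
    rw [h]
    exact ((integrable_extVirtualValue_mul_alloc a i).const_mul _).add
      ((integrable_alloc a i).const_mul _)
  refine integral_mono_ae (hint a) (hint _) ?_
  filter_upwards [M.ae_nonneg, M.ae_pdf_pos] with v hv hpos
  exact sum_score_mul_le (c : ℝ) w (fun i => ⟨v i, le_rfl, hpos i⟩) (a.alloc_nonneg v hv)
    (a.sum_alloc_le_one v hv)

/-- The one-round reward plus the expected continuation value, in real numbers. -/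
theorem reward_add_sum_showProb (a : Mechanism n) (c : unitInterval) {W : Option (Fin n) → ℝ≥0∞}
    (hW : ∀ o, W o ≠ ∞) :
    M.reward a c + ∑ o, M.showProb a o * W o
      = ENNReal.ofReal (c * ∑ i, M.meanPay a i
        + ∑ i, ((W (some i)).toReal - (W none).toReal) * M.winProb a i + (W none).toReal) := by
  have hp := fun i => winProb_nonneg a i (M := M)
  have h1 := sum_winProb_le_one a (M := M)
  have hm : 0 ≤ ∑ i, M.meanPay a i := Finset.sum_nonneg fun i _ => meanPay_nonneg a i
  rw [reward, expectedPayment_eq, ← ENNReal.ofReal_mul c.2.1, Fintype.sum_option, showProb_none]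
  simp_rw [showProb_some]
  conv_lhs => enter [2, 1]; rw [← ENNReal.ofReal_toReal (hW none)]
  conv_lhs => enter [2, 2, 2, i]; rw [← ENNReal.ofReal_toReal (hW (some i)),
    ← ENNReal.ofReal_mul (hp i)]
  have h2 : ∀ i, 0 ≤ M.winProb a i * (W (some i)).toReal := fun i =>
    mul_nonneg (hp i) ENNReal.toReal_nonneg
  have h3 : 0 ≤ (1 - ∑ i, M.winProb a i) * (W none).toReal :=
    mul_nonneg (by linarith) ENNReal.toReal_nonneg
  rw [← ENNReal.ofReal_mul (by linarith), ← ENNReal.ofReal_sum_of_nonneg fun i _ => h2 i,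
    ← ENNReal.ofReal_add h3 (Finset.sum_nonneg fun i _ => h2 i),
    ← ENNReal.ofReal_add (mul_nonneg c.2.1 hm)
      (add_nonneg h3 (Finset.sum_nonneg fun i _ => h2 i))]
  congr 1
  simp only [sub_mul, Finset.sum_sub_distrib, ← Finset.mul_sum]
  simp only [mul_comm (M.winProb a _)]
  ring

/-- Since the showing probabilities sum to one, showing no ad can serve as the baseline; hence the
weights are differences with `W none`. -/
theorem reward_add_le_scoreMech (hreg : ∀ i, (M.dist i).Regular) (a : Mechanism n)
    (c : unitInterval) {W : Option (Fin n) → ℝ≥0∞} (hW : ∀ o, W o ≠ ∞) :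
    M.reward a c + ∑ o, M.showProb a o * W o
      ≤ M.reward (M.scoreMech hreg c fun i => (W (some i)).toReal - (W none).toReal) c
        + ∑ o, M.showProb (M.scoreMech hreg c fun i => (W (some i)).toReal - (W none).toReal) o
          * W o := by
  rw [reward_add_sum_showProb a c hW, reward_add_sum_showProb _ c hW]
  exact ENNReal.ofReal_le_ofReal
    (add_le_add_left (weighted_revenue_le_scoreMech hreg a c _) _)

theorem measurable_winProb_of {α : Type*} [MeasurableSpace α] {a : α → Mechanism n} {i : Fin n}
    (h : Measurable fun p : α × (Fin n → ℝ) => (a p.1).alloc p.2 i) :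
    Measurable fun x => M.winProb (a x) i :=
  (StronglyMeasurable.integral_prod_right' h.stronglyMeasurable).measurable

theorem measurable_showProb_of {α : Type*} [MeasurableSpace α] {a : α → Mechanism n}
    (h : ∀ i, Measurable fun x => M.winProb (a x) i) (o : Option (Fin n)) :
    Measurable fun x => M.showProb (a x) o := by
  cases o with
  | none =>
    simp_rw [showProb_none]
    exact (measurable_const.sub (Finset.measurable_sum _ fun i _ => h i)).ennreal_ofReal
  | some i =>
    simp_rw [showProb_some]
    exact (h i).ennreal_ofReal

variable (M)

/-- The policy that runs the score auction with weights depending measurably on the state. -/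
noncomputable def scorePolicy (hreg : ∀ i, (M.dist i).Regular) (w : unitInterval → Fin n → ℝ)
    (hw : Measurable w) : M.Policy where
  mech ctr := M.scoreMech hreg ctr (w ctr)
  measurable_showProb := by
    refine measurable_showProb_of fun i => measurable_winProb_of ?_
    exact (measurable_scoreAlloc_apply (M := M) i).comp
      (((measurable_subtype_coe.comp measurable_fst).prodMk (hw.comp measurable_fst)).prodMk
        measurable_snd)
  measurable_expectedPayment := by
    simp_rw [expectedPayment_eq, meanPay_scoreMech]
    refine (Finset.measurable_sum _ fun i _ => ?_).ennreal_ofReal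
    refine (StronglyMeasurable.integral_prod_right' (f := fun p : unitInterval × (Fin n → ℝ) =>
      (M.dist i).extVirtualValue (p.2 i) * M.scoreAlloc p.1 (w p.1) p.2 i) ?_).measurable
    refine Measurable.stronglyMeasurable (((M.dist i).measurable_extVirtualValue.comp
      ((measurable_pi_apply i).comp measurable_snd)).mul ?_)
    exact (measurable_scoreAlloc_apply (M := M) i).comp
      (((measurable_subtype_coe.comp measurable_fst).prodMk (hw.comp measurable_fst)).prodMk
        measurable_snd)

end AdMDP

/-! ### Dynamic programming: an optimal stationary policy -/

namespace AdMDP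

variable {n : ℕ} {M : AdMDP n}

instance isMarkovKernel_P (o : Option (Fin n)) : IsMarkovKernel (M.P o) := M.markov o

namespace Policy

variable (π : M.Policy)

theorem measurable_reward : Measurable fun ctr => M.reward (π.mech ctr) ctr :=
  measurable_subtype_coe.ennreal_ofReal.mul π.measurable_expectedPayment

theorem lintegral_transition (f : unitInterval → ℝ≥0∞) (ctr : unitInterval) :
    ∫⁻ s, f s ∂π.transition ctr = ∑ o, M.showProb (π.mech ctr) o * ∫⁻ s, f s ∂M.P o ctr := by
  change ∫⁻ s, f s ∂(∑ o : Option (Fin n), M.showProb (π.mech ctr) o • M.P o ctr) = _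
  simp [lintegral_finsetSum_measure, lintegral_smul_measure]

instance isMarkovKernel_transition : IsMarkovKernel π.transition := by
  refine ⟨fun ctr => ⟨?_⟩⟩
  have h := π.lintegral_transition 1 ctr
  simpa only [Pi.one_apply, lintegral_one, measure_univ, mul_one, sum_showProb] using h

instance isProbabilityMeasure_stateLaw (ctr₀ : unitInterval) (t : ℕ) :
    IsProbabilityMeasure (π.stateLaw ctr₀ t) := by
  induction t with
  | zero => exact Measure.dirac.isProbabilityMeasure
  | succ t ih => exact isProbabilityMeasure_bind π.transition.aemeasurable (.of_forall fun _ => inferInstance)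

theorem lintegral_stateLaw_succ {f : unitInterval → ℝ≥0∞} (hf : Measurable f) (ctr₀ : unitInterval)
    (t : ℕ) : ∫⁻ s, f s ∂π.stateLaw ctr₀ (t + 1)
      = ∫⁻ c, (∑ o, M.showProb (π.mech c) o * ∫⁻ s, f s ∂M.P o c) ∂π.stateLaw ctr₀ t := by
  change ∫⁻ s, f s ∂(π.stateLaw ctr₀ t).bind π.transition = _
  rw [Measure.lintegral_bind π.transition.aemeasurable hf.aemeasurable]
  simp_rw [lintegral_transition]

end Policy

/-- The continuation value of showing ad `o` in state `ctr`. -/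
noncomputable def continuation (M : AdMDP n) (V : unitInterval → ℝ≥0∞) (ctr : unitInterval)
    (o : Option (Fin n)) : ℝ≥0∞ :=
  M.γ * ∫⁻ s, V s ∂M.P o ctr

/-- The value of using mechanism `a` once and continuing with value `V`. -/
noncomputable def oneStep (M : AdMDP n) (V : unitInterval → ℝ≥0∞) (a : Mechanism n)
    (ctr : unitInterval) : ℝ≥0∞ :=
  M.reward a ctr + ∑ o, M.showProb a o * M.continuation V ctr o

/-- The Bellman operator. -/
noncomputable def bellman (M : AdMDP n) (V : unitInterval → ℝ≥0∞) (ctr : unitInterval) : ℝ≥0∞ :=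
  ⨆ a, M.oneStep V a ctr

theorem oneStep_mono {V W : unitInterval → ℝ≥0∞} (h : V ≤ W) (a : Mechanism n)
    (ctr : unitInterval) : M.oneStep V a ctr ≤ M.oneStep W a ctr := by
  unfold oneStep continuation
  gcongr with o _ s
  exact h s

theorem bellman_mono {V W : unitInterval → ℝ≥0∞} (h : V ≤ W) : M.bellman V ≤ M.bellman W :=
  fun ctr => iSup_mono fun a => oneStep_mono h a ctr

/-- An upper bound on all values. -/
noncomputable def valueBound (M : AdMDP n) : ℝ≥0 :=
  (∑ i, ∫ v, v i ∂M.valueLaw).toNNReal / (1 - M.γ)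

theorem reward_le (a : Mechanism n) (ctr : unitInterval) :
    M.reward a ctr ≤ (∑ i, ∫ v, v i ∂M.valueLaw).toNNReal := by
  refine (mul_le_mul' ?_ (expectedPayment_le a)).trans (one_mul _).le
  simpa using ENNReal.ofReal_le_ofReal ctr.2.2

theorem continuation_le {V : unitInterval → ℝ≥0∞} {B : ℝ≥0∞} (hV : ∀ s, V s ≤ B)
    (ctr : unitInterval) (o : Option (Fin n)) : M.continuation V ctr o ≤ M.γ * B := by
  unfold continuation
  gcongr
  exact (lintegral_mono hV).trans (by simp)

theorem bellman_le_valueBound {V : unitInterval → ℝ≥0∞} (hV : ∀ s, V s ≤ M.valueBound)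
    (ctr : unitInterval) : M.bellman V ctr ≤ M.valueBound := by
  refine iSup_le fun a => ?_
  calc M.oneStep V a ctr
      ≤ (∑ i, ∫ v, v i ∂M.valueLaw).toNNReal + ∑ o, M.showProb a o * (M.γ * M.valueBound) := by
        unfold oneStep
        gcongr with o
        · exact reward_le a ctr
        · exact continuation_le hV ctr o
    _ = M.valueBound := by
        rw [← Finset.sum_mul, sum_showProb, one_mul]
        have h1 : (1 - M.γ : ℝ≥0) ≠ 0 := (tsub_pos_of_lt M.γ_lt_one).ne'
        have h2 : (∑ i, ∫ v, v i ∂M.valueLaw).toNNReal = (1 - M.γ) * M.valueBound := by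
          rw [valueBound, mul_div_cancel₀ _ h1]
        rw [h2, ← ENNReal.coe_mul, ← ENNReal.coe_add, ← add_mul,
          tsub_add_cancel_of_le M.γ_lt_one.le, one_mul]

theorem measurable_continuation {V : unitInterval → ℝ≥0∞} (hV : Measurable V)
    (o : Option (Fin n)) : Measurable fun ctr => M.continuation V ctr o :=
  (Measurable.lintegral_kernel hV).const_mul _

theorem continuation_ne_top {V : unitInterval → ℝ≥0∞} (hVB : ∀ s, V s ≤ M.valueBound)
    (ctr : unitInterval) (o : Option (Fin n)) : M.continuation V ctr o ≠ ∞ :=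
  ne_top_of_le_ne_top (by simp [ENNReal.mul_eq_top]) (continuation_le hVB ctr o)

/-- The greedy policy for the continuation value `V`. -/
noncomputable def greedy (M : AdMDP n) (hreg : ∀ i, (M.dist i).Regular)
    (V : unitInterval → ℝ≥0∞) (hV : Measurable V) : M.Policy :=
  M.scorePolicy hreg
    (fun ctr i => (M.continuation V ctr (some i)).toReal - (M.continuation V ctr none).toReal)
    (measurable_pi_lambda _ fun i => (measurable_continuation hV (some i)).ennreal_toReal.sub
      (measurable_continuation hV none).ennreal_toReal)

/-- The supremum over all mechanisms is attained by a choice measurable in the state, which gives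
the measurability of the iterates. -/
theorem bellman_eq_oneStep_greedy (hreg : ∀ i, (M.dist i).Regular) {V : unitInterval → ℝ≥0∞}
    (hV : Measurable V) (hVB : ∀ s, V s ≤ M.valueBound) (ctr : unitInterval) :
    M.bellman V ctr = M.oneStep V ((M.greedy hreg V hV).mech ctr) ctr :=
  le_antisymm
    (iSup_le fun a => reward_add_le_scoreMech hreg a ctr (continuation_ne_top hVB ctr))
    (le_iSup (fun a => M.oneStep V a ctr) _)

theorem Policy.measurable_oneStep (π : M.Policy) {V : unitInterval → ℝ≥0∞} (hV : Measurable V) :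
    Measurable fun ctr => M.oneStep V (π.mech ctr) ctr :=
  π.measurable_reward.add (Finset.measurable_sum _ fun o _ =>
    (π.measurable_showProb o).mul (measurable_continuation hV o))

theorem Policy.lintegral_oneStep (π : M.Policy) {V : unitInterval → ℝ≥0∞} (hV : Measurable V)
    (ctr₀ : unitInterval) (t : ℕ) :
    ∫⁻ c, M.oneStep V (π.mech c) c ∂π.stateLaw ctr₀ t
      = ∫⁻ c, M.reward (π.mech c) c ∂π.stateLaw ctr₀ t
        + M.γ * ∫⁻ s, V s ∂π.stateLaw ctr₀ (t + 1) := by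
  unfold oneStep continuation
  rw [lintegral_add_left π.measurable_reward, π.lintegral_stateLaw_succ hV,
    ← lintegral_const_mul' _ _ ENNReal.coe_ne_top]
  simp_rw [Finset.mul_sum, mul_left_comm]

/-- The discounted revenue of the first `N` rounds. -/
noncomputable def Policy.partialValue (π : M.Policy) (ctr₀ : unitInterval) (N : ℕ) : ℝ≥0∞ :=
  ∑ t ∈ Finset.range N, (M.γ : ℝ≥0∞) ^ t * ∫⁻ c, M.reward (π.mech c) c ∂π.stateLaw ctr₀ t

/-- Telescoping: in round `N` the hypothesis replaces the remainder by that round's reward plus the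
next remainder. -/
theorem Policy.partialValue_add_le (π : M.Policy) {V : unitInterval → ℝ≥0∞} (hV : Measurable V)
    (h : ∀ c, M.oneStep V (π.mech c) c ≤ V c) (ctr₀ : unitInterval) (N : ℕ) :
    π.partialValue ctr₀ N + (M.γ : ℝ≥0∞) ^ N * ∫⁻ s, V s ∂π.stateLaw ctr₀ N ≤ V ctr₀ := by
  induction N with
  | zero => simp [Policy.partialValue, Policy.stateLaw, lintegral_dirac' _ hV]
  | succ N ih =>
    refine le_trans ?_ ih
    rw [partialValue, Finset.sum_range_succ, add_assoc, pow_succ, mul_assoc, ← mul_add,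
      ← π.lintegral_oneStep hV]
    unfold partialValue
    gcongr
    exact h _

theorem Policy.le_partialValue_add (π : M.Policy) {V : unitInterval → ℝ≥0∞} (hV : Measurable V)
    (h : ∀ c, V c ≤ M.oneStep V (π.mech c) c) (ctr₀ : unitInterval) (N : ℕ) :
    V ctr₀ ≤ π.partialValue ctr₀ N + (M.γ : ℝ≥0∞) ^ N * ∫⁻ s, V s ∂π.stateLaw ctr₀ N := by
  induction N with
  | zero => simp [Policy.partialValue, Policy.stateLaw, lintegral_dirac' _ hV]
  | succ N ih =>
    refine ih.trans ?_
    rw [partialValue, partialValue, Finset.sum_range_succ, add_assoc, pow_succ, mul_assoc,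
      ← mul_add, ← π.lintegral_oneStep hV]
    gcongr
    exact h _

theorem Policy.value_le (π : M.Policy) {V : unitInterval → ℝ≥0∞} (hV : Measurable V)
    (h : ∀ c, M.oneStep V (π.mech c) c ≤ V c) (ctr₀ : unitInterval) : π.value ctr₀ ≤ V ctr₀ := by
  unfold Policy.value
  rw [ENNReal.tsum_eq_iSup_nat]
  exact iSup_le fun N => le_self_add.trans (π.partialValue_add_le hV h ctr₀ N)

/-- For a lower bound the remainder cannot be dropped; it vanishes because `V` is bounded and `γ <
1`. -/
theorem Policy.le_value (π : M.Policy) {V : unitInterval → ℝ≥0∞} (hV : Measurable V)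
    (hVB : ∀ s, V s ≤ M.valueBound) (h : ∀ c, V c ≤ M.oneStep V (π.mech c) c)
    (ctr₀ : unitInterval) : V ctr₀ ≤ π.value ctr₀ := by
  have hN : ∀ N : ℕ, V ctr₀ ≤ π.value ctr₀ + (M.γ : ℝ≥0∞) ^ N * M.valueBound := by
    intro N
    refine (π.le_partialValue_add hV h ctr₀ N).trans ?_
    gcongr
    · exact ENNReal.sum_le_tsum _
    · exact (lintegral_mono hVB).trans (by simp)
  have hlim : Filter.Tendsto (fun N : ℕ => π.value ctr₀ + (M.γ : ℝ≥0∞) ^ N * M.valueBound)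
      Filter.atTop (nhds (π.value ctr₀ + 0 * M.valueBound)) :=
    tendsto_const_nhds.add (ENNReal.Tendsto.mul_const
      (ENNReal.tendsto_pow_atTop_nhds_zero_of_lt_one (by exact_mod_cast M.γ_lt_one))
      (Or.inr ENNReal.coe_ne_top))
  simpa using ge_of_tendsto' hlim hN

/-- Value iteration. -/
noncomputable def valueIter (M : AdMDP n) : ℕ → unitInterval → ℝ≥0∞
  | 0 => 0
  | k + 1 => M.bellman (M.valueIter k)

theorem monotone_valueIter : Monotone M.valueIter := by
  refine monotone_nat_of_le_succ fun k => ?_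
  induction k with
  | zero => exact zero_le
  | succ k ih => exact bellman_mono ih

theorem valueIter_le (k : ℕ) (s : unitInterval) : M.valueIter k s ≤ M.valueBound := by
  induction k generalizing s with
  | zero => exact zero_le
  | succ k ih => exact bellman_le_valueBound ih s

theorem measurable_valueIter (hreg : ∀ i, (M.dist i).Regular) (k : ℕ) :
    Measurable (M.valueIter k) := by
  induction k with
  | zero => exact measurable_const
  | succ k ih =>
    have : M.valueIter (k + 1)
        = fun ctr => M.oneStep (M.valueIter k) ((M.greedy hreg _ ih).mech ctr) ctr :=
      funext fun ctr => bellman_eq_oneStep_greedy hreg ih (valueIter_le k) ctr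
    rw [this]
    exact Policy.measurable_oneStep _ ih

/-- The limit of value iteration. -/
noncomputable def valueLimit (M : AdMDP n) (ctr : unitInterval) : ℝ≥0∞ := ⨆ k, M.valueIter k ctr

theorem measurable_valueLimit (hreg : ∀ i, (M.dist i).Regular) : Measurable M.valueLimit :=
  Measurable.iSup fun k => measurable_valueIter hreg k

theorem valueLimit_le (s : unitInterval) : M.valueLimit s ≤ M.valueBound :=
  iSup_le fun k => valueIter_le k s

theorem valueLimit_le_bellman (ctr : unitInterval) : M.valueLimit ctr ≤ M.bellman M.valueLimit ctr := by
  refine iSup_le fun k => (monotone_valueIter k.le_succ ctr).trans ?_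
  exact bellman_mono (fun s => le_iSup (fun k => M.valueIter k s) k) ctr

/-- Monotone convergence for a fixed mechanism; it makes the limit of value iteration dominate its
own one-step values. -/
theorem oneStep_valueLimit (hreg : ∀ i, (M.dist i).Regular) (a : Mechanism n)
    (ctr : unitInterval) : M.oneStep M.valueLimit a ctr = ⨆ k, M.oneStep (M.valueIter k) a ctr := by
  unfold oneStep continuation valueLimit
  simp_rw [lintegral_iSup (measurable_valueIter hreg) monotone_valueIter, ENNReal.mul_iSup]
  rw [ENNReal.finsetSum_iSup_of_monotone, ENNReal.add_iSup]
  intro o k l hkl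
  dsimp only
  gcongr
  exact monotone_valueIter hkl _

theorem oneStep_valueLimit_le (hreg : ∀ i, (M.dist i).Regular) (a : Mechanism n)
    (ctr : unitInterval) : M.oneStep M.valueLimit a ctr ≤ M.valueLimit ctr := by
  rw [oneStep_valueLimit hreg]
  exact iSup_le fun k => (le_iSup (fun a => M.oneStep (M.valueIter k) a ctr) a).trans
    (le_iSup (fun k => M.valueIter k ctr) (k + 1))

/-- There is an optimal stationary policy. -/
theorem exists_optimal_policy (hreg : ∀ i, (M.dist i).Regular) :
    ∃ π : M.Policy, ∀ ctr, π.value ctr = M.optValue ctr := by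
  have hV := measurable_valueLimit hreg
  refine ⟨M.greedy hreg _ hV, fun ctr => le_antisymm (le_iSup (fun π : M.Policy => π.value ctr) _) ?_⟩
  -- The limit of value iteration lies between the values of all policies and the value of its
  -- greedy policy.
  refine (iSup_le fun π => π.value_le hV (fun c => oneStep_valueLimit_le hreg _ c) ctr).trans ?_
  refine Policy.le_value _ hV valueLimit_le (fun c => ?_) ctr
  rw [← bellman_eq_oneStep_greedy hreg hV valueLimit_le]
  exact valueLimit_le_bellman c

end AdMDP

/-! ### Prices as functions of the sale probability -/

namespace ValueDistribution

variable (F : ValueDistribution)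

theorem continuous_cdf : Continuous (cdf F.law) := by
  refine continuous_iff_continuousAt.2 fun x => ?_
  have h : (cdf F.law).measure {x} = 0 := by rw [measure_cdf]; exact measure_singleton x
  rw [StieltjesFunction.measure_singleton, ENNReal.ofReal_eq_zero, sub_nonpos] at h
  rw [(cdf F.law).mono.continuousAt_iff_leftLim_eq_rightLim, StieltjesFunction.rightLim_eq]
  exact le_antisymm ((cdf F.law).mono.leftLim_le le_rfl) h

theorem cdf_eq_zero_of_notMem_reached {v : ℝ} (hv : v ∉ F.reached) : cdf F.law v = 0 := by
  have h : F.law (Set.Iic v) = 0 := by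
    rw [law, withDensity_apply _ measurableSet_Iic]
    refine (setLIntegral_congr_fun measurableSet_Iic fun u hu => ?_).trans lintegral_zero
    rw [ENNReal.ofReal_eq_zero]
    by_contra h
    exact hv ⟨u, hu, not_le.1 h⟩
  rw [← ofReal_cdf, ENNReal.ofReal_eq_zero] at h
  exact le_antisymm h (cdf_nonneg _ _)

theorem cdf_zero : cdf F.law 0 = 0 := by
  have h : F.law (Set.Iic 0) = 0 := by
    rw [← measure_congr Iio_ae_eq_Iic]
    have := F.ae_nonneg
    rw [ae_iff] at this
    simpa [Set.Iio] using this
  rw [← ofReal_cdf, ENNReal.ofReal_eq_zero] at h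
  exact le_antisymm h (cdf_nonneg _ _)

/-- The largest price at which the sale probability is at least `q`. -/
noncomputable def priceAt (q : ℝ) : ℝ := sSup {v | cdf F.law v ≤ 1 - q}

theorem bddAbove_cdf_le {q : ℝ} (hq : 0 < q) : BddAbove {v | cdf F.law v ≤ 1 - q} := by
  obtain ⟨B, hB⟩ := ((tendsto_cdf_atTop F.law).eventually
    (lt_mem_nhds (show 1 - q < 1 by linarith))).exists
  exact ⟨B, fun v hv => le_of_not_gt fun h =>
    absurd (hB.trans_le ((monotone_cdf F.law h.le).trans hv)) (lt_irrefl _)⟩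

variable {q : ℝ}

theorem priceAt_nonneg (hq : 0 < q) (hq1 : q ≤ 1) : 0 ≤ F.priceAt q :=
  le_csSup (F.bddAbove_cdf_le hq) (by rw [Set.mem_ofPred_eq, cdf_zero]; linarith)

theorem lt_cdf_of_priceAt_lt (hq : 0 < q) {v : ℝ} (hv : F.priceAt q < v) :
    1 - q < cdf F.law v := by
  by_contra! h
  exact absurd (le_csSup (F.bddAbove_cdf_le hq) h) (not_le.2 hv)

/-- Without atoms the distribution function is continuous, so every sale probability is hit exactly.
-/
theorem cdf_priceAt (hq : 0 < q) (hq1 : q ≤ 1) : cdf F.law (F.priceAt q) = 1 - q := by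
  refine le_antisymm ?_ ?_
  · exact (isClosed_le F.continuous_cdf continuous_const).csSup_mem
      ⟨0, by rw [Set.mem_ofPred_eq, cdf_zero]; linarith⟩ (F.bddAbove_cdf_le hq)
  · refine ge_of_tendsto (x := nhdsWithin (F.priceAt q) (Set.Ioi (F.priceAt q)))
      (F.continuous_cdf.continuousAt.tendsto.mono_left nhdsWithin_le_nhds) ?_
    filter_upwards [self_mem_nhdsWithin] with v hv using (F.lt_cdf_of_priceAt_lt hq hv).le

theorem law_Ici_priceAt (hq : 0 < q) (hq1 : q ≤ 1) :
    F.law (Set.Ici (F.priceAt q)) = ENNReal.ofReal q := by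
  rw [law_Ici, F.cdf_priceAt hq hq1, sub_sub_cancel]

theorem law_real_Ioi_priceAt (hq : 0 < q) (hq1 : q ≤ 1) :
    F.law.real (Set.Ioi (F.priceAt q)) = q := by
  rw [measureReal_def, law_Ioi, F.cdf_priceAt hq hq1, sub_sub_cancel, ENNReal.toReal_ofReal hq.le]

theorem mem_reached_of_priceAt_lt (hq : 0 < q) (hq1 : q ≤ 1) {v : ℝ} (hv : F.priceAt q < v) :
    v ∈ F.reached := by
  by_contra h
  have := F.lt_cdf_of_priceAt_lt hq hv
  rw [F.cdf_eq_zero_of_notMem_reached h] at this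
  linarith

open Classical in
/-- The reserve price that a bidder meets with probability `q`. -/
noncomputable def reserveAt (q : ℝ) : ℝ≥0∞ := if q ≤ 0 then ∞ else ENNReal.ofReal (F.priceAt q)

theorem reserveAt_of_pos (hq : 0 < q) : F.reserveAt q = ENNReal.ofReal (F.priceAt q) :=
  if_neg (not_le.2 hq)

theorem antitone_reserveAt : Antitone F.reserveAt := by
  intro p q hpq
  unfold reserveAt
  split_ifs with h1 h2 h2
  · exact le_rfl
  · exact absurd (hpq.trans h1) h2
  · exact le_top
  -- The set is empty only for `q > 1`, where the price takes the default value 0.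
  · rcases Set.eq_empty_or_nonempty {v | cdf F.law v ≤ 1 - q} with h | h
    · rw [priceAt, h, Real.sSup_empty]; simp
    · exact ENNReal.ofReal_le_ofReal (csSup_le_csSup (F.bddAbove_cdf_le (not_le.1 h2)) h
        fun v hv => show cdf F.law v ≤ 1 - p from
          (show cdf F.law v ≤ 1 - q from hv).trans (by linarith))

theorem measurable_reserveAt : Measurable F.reserveAt := F.antitone_reserveAt.measurable

theorem law_reserveAt_le (hq : 0 ≤ q) (hq1 : q ≤ 1) :
    F.law {y | F.reserveAt q ≤ ENNReal.ofReal y} = ENNReal.ofReal q := by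
  rcases hq.eq_or_lt with rfl | hq
  · simp [reserveAt]
  · rw [← F.law_Ici_priceAt hq hq1]
    refine measure_congr ?_
    filter_upwards [F.ae_nonneg] with y hy
    rw [eq_iff_iff]
    change F.reserveAt q ≤ ENNReal.ofReal y ↔ F.priceAt q ≤ y
    rw [F.reserveAt_of_pos hq, ENNReal.ofReal_le_ofReal_iff hy]

theorem integrable_invHazard : Integrable F.invHazard F.law := by
  refine ⟨F.measurable_invHazard.aestronglyMeasurable, ?_⟩
  rw [hasFiniteIntegral_iff_ofReal (.of_forall F.invHazard_nonneg)]
  have h := lintegral_mul_invHazard_le (F := F) (g := 1) measurable_one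
  simp only [Pi.one_apply, one_mul, lintegral_one, Measure.restrict_apply_univ,
    Real.volume_Ioc, sub_zero] at h
  exact h.trans_lt F.integrable_id.lintegral_lt_top

theorem extVirtualValue_ae_eq :
    F.extVirtualValue =ᵐ[F.law] fun v => v - F.invHazard v := by
  filter_upwards [F.ae_pdf_pos] with v hv
  rw [extVirtualValue, if_pos hv, virtualValue_eq]

theorem integrable_extVirtualValue : Integrable F.extVirtualValue F.law :=
  (F.integrable_id.sub F.integrable_invHazard).congr F.extVirtualValue_ae_eq.symm

/-- The virtual surplus of a posted price is its revenue. -/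
theorem Regular.setIntegral_extVirtualValue {F : ValueDistribution} (h : F.Regular) (hq : 0 < q)
    (hq1 : q ≤ 1) :
    ∫ v in Set.Ioi (F.priceAt q), F.extVirtualValue v ∂F.law = F.priceAt q * q := by
  have h0 := F.priceAt_nonneg hq hq1
  have hg : Measurable ((Set.Ioi (F.priceAt q)).indicator (1 : ℝ → ℝ≥0∞)) :=
    measurable_one.indicator measurableSet_Ioi
  -- Myerson's identity for the rule that sells above the price; its rent is the positive part of `v
  -- - F.priceAt q`.
  have key := h.lintegral_mul_invHazard_eq hg fun z hz =>
    Set.indicator_of_notMem (fun hz' => hz (F.mem_reached_of_priceAt_lt hq hq1 hz')) _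
  have h1 : ∀ v, ∫⁻ z in Set.Ioc 0 v, (Set.Ioi (F.priceAt q)).indicator (1 : ℝ → ℝ≥0∞) z
      = (Set.Ioi (F.priceAt q)).indicator (fun v => ENNReal.ofReal (v - F.priceAt q)) v := by
    intro v
    rw [lintegral_indicator_one measurableSet_Ioi, Measure.restrict_apply measurableSet_Ioi]
    have : Set.Ioi (F.priceAt q) ∩ Set.Ioc 0 v = Set.Ioc (F.priceAt q) v := by
      ext z; simp only [Set.mem_inter_iff, Set.mem_Ioi, Set.mem_Ioc]
      constructor
      · rintro ⟨a, -, b⟩; exact ⟨a, b⟩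
      · rintro ⟨a, b⟩; exact ⟨a, h0.trans_lt a, b⟩
    rw [this, Real.volume_Ioc]
    by_cases hv : F.priceAt q < v
    · rw [Set.indicator_of_mem (Set.mem_Ioi.2 hv)]
    · rw [Set.indicator_of_notMem (by simpa using hv), ENNReal.ofReal_of_nonpos]
      linarith
  have h2 : ∀ z, (Set.Ioi (F.priceAt q)).indicator (1 : ℝ → ℝ≥0∞) z
      * ENNReal.ofReal (F.invHazard z)
      = (Set.Ioi (F.priceAt q)).indicator (fun z => ENNReal.ofReal (F.invHazard z)) z := by
    intro z; by_cases hz : z ∈ Set.Ioi (F.priceAt q) <;> simp [hz]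
  simp_rw [h1, h2] at key
  have hint := F.integrable_id.sub (integrable_const (F.priceAt q))
  have hnn : 0 ≤ᵐ[F.law.restrict (Set.Ioi (F.priceAt q))] fun v => v - F.priceAt q :=
    (ae_restrict_iff' measurableSet_Ioi).2 (.of_forall fun v hv => sub_nonneg.2 (le_of_lt hv))
  rw [lintegral_indicator measurableSet_Ioi, lintegral_indicator measurableSet_Ioi,
    ← ofReal_integral_eq_lintegral_ofReal F.integrable_invHazard.integrableOn
      (.of_forall F.invHazard_nonneg),
    ← ofReal_integral_eq_lintegral_ofReal (f := fun v => v - F.priceAt q) hint.integrableOn hnn,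
    ENNReal.ofReal_eq_ofReal_iff (integral_nonneg F.invHazard_nonneg)
      (integral_nonneg_of_ae hnn),
    integral_sub F.integrable_id.integrableOn (integrable_const _)] at key
  rw [integral_congr_ae (ae_restrict_of_ae F.extVirtualValue_ae_eq),
    integral_sub F.integrable_id.integrableOn F.integrable_invHazard.integrableOn, key,
    setIntegral_const, F.law_real_Ioi_priceAt hq hq1, smul_eq_mul]
  ring

end ValueDistribution

/-! ### The ex ante bound on the payment of one bidder -/

namespace AdMDP

variable {n : ℕ} {M : AdMDP n} (a : Mechanism n) (i : Fin n)

theorem winProb_le_one : M.winProb a i ≤ 1 :=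
  (Finset.single_le_sum (fun j _ => winProb_nonneg a j) (Finset.mem_univ i)).trans
    (sum_winProb_le_one a)

theorem integral_comp_eval {f : ℝ → ℝ} (hf : Measurable f) :
    ∫ v, f (v i) ∂M.valueLaw = ∫ y, f y ∂(M.dist i).law := by
  rw [← (M.measurePreserving_eval i).map_eq,
    integral_map (measurable_pi_apply i).aemeasurable hf.aestronglyMeasurable]

/-- Whatever the mechanism, a bidder who wins with probability `q` pays in expectation at most the
revenue of the posted price that sells with probability `q`. -/
theorem meanPay_le_price_mul_winProb (hreg : (M.dist i).Regular) :
    M.meanPay a i ≤ ((M.dist i).reserveAt (M.winProb a i)).toReal * M.winProb a i := by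
  rcases (winProb_nonneg a i (M := M)).eq_or_lt with h0 | hq
  · rw [← h0, mul_zero]
    have hx : (fun v => a.alloc v i) =ᵐ[M.valueLaw] 0 :=
      (integral_eq_zero_iff_of_nonneg_ae (ae_alloc_nonneg a i) (integrable_alloc a i)).1 h0.symm
    refine integral_nonpos_of_ae ?_
    filter_upwards [M.ae_nonneg, hx] with v hv hx
    have := a.pay_le hv i
    simp only [Pi.zero_apply] at hx ⊢
    rwa [hx, mul_zero] at this
  have hq1 := winProb_le_one a i (M := M)
  set q := M.winProb a i with hqdef
  have h0 := (M.dist i).priceAt_nonneg hq hq1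
  rw [(M.dist i).reserveAt_of_pos hq, ENNReal.toReal_ofReal h0,
    ← hreg.setIntegral_extVirtualValue hq hq1, ← integral_indicator measurableSet_Ioi,
    ← integral_comp_eval (M := M) i
      ((M.dist i).measurable_extVirtualValue.indicator measurableSet_Ioi)]
  refine (meanPay_le_virtualSurplus a i).trans ?_
  set ρ := (M.dist i).priceAt q
  set s : ℝ → ℝ := (Set.Ioi ρ).indicator 1 with hs
  have hsm : Measurable s := measurable_one.indicator measurableSet_Ioi
  have hs_int : Integrable (fun v : Fin n → ℝ => s (v i)) M.valueLaw := by
    refine (integrable_const (1 : ℝ)).mono' (hsm.comp (measurable_pi_apply i)).aestronglyMeasurable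
      (.of_forall fun v => ?_)
    by_cases h : v i ∈ Set.Ioi ρ <;> simp [hs, h]
  have hs_val : ∫ v, s (v i) ∂M.valueLaw = q := by
    rw [integral_comp_eval i hsm, hs, integral_indicator_one measurableSet_Ioi,
      (M.dist i).law_real_Ioi_priceAt hq hq1]
  have hφ_int : Integrable (fun v : Fin n → ℝ =>
      (Set.Ioi ρ).indicator (M.dist i).extVirtualValue (v i)) M.valueLaw :=
    (M.measurePreserving_eval i).integrable_comp_of_integrable
      ((M.dist i).integrable_extVirtualValue.indicator measurableSet_Ioi)
  rcases hq1.lt_or_eq with hq1' | hq1'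
  · have hρ : ρ ∈ (M.dist i).reached := by
      by_contra h
      have := (M.dist i).cdf_eq_zero_of_notMem_reached h
      rw [(M.dist i).cdf_priceAt hq hq1] at this
      linarith
    -- Exchange argument: moving winning probability across `ρ` cannot help, as `(φ(v) - φ(ρ)) *
    -- (a.alloc v i - s (v i)) ≤ 0` with `φ` the extended virtual value. The right side integrates
    -- to zero because both rules have mean `q`.
    have key : ∫ v, ((M.dist i).extVirtualValue (v i) * a.alloc v i
          - (Set.Ioi ρ).indicator (M.dist i).extVirtualValue (v i)) ∂M.valueLaw
        ≤ ∫ v, (M.dist i).extVirtualValue ρ * (a.alloc v i - s (v i)) ∂M.valueLaw := by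
      refine integral_mono_ae ((integrable_extVirtualValue_mul_alloc a i).sub hφ_int)
        (((integrable_alloc a i).sub hs_int).const_mul _) ?_
      filter_upwards [M.ae_nonneg, M.ae_pdf_pos] with v hv hpos
      have hvr : v i ∈ (M.dist i).reached := ⟨v i, le_rfl, hpos i⟩
      have hmono := hreg.monotoneOn_extVirtualValue
      by_cases h : v i ∈ Set.Ioi ρ
      · have := hmono hρ hvr (le_of_lt h)
        simp only [hs, h, Set.indicator_of_mem, Pi.one_apply]
        nlinarith [a.alloc_le_one hv i]
      · have := hmono hvr hρ (not_lt.1 h)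
        simp only [hs, h, not_false_eq_true, Set.indicator_of_notMem]
        nlinarith [a.alloc_nonneg v hv i]
    rw [integral_const_mul, integral_sub (integrable_extVirtualValue_mul_alloc a i) hφ_int,
      integral_sub (integrable_alloc a i) hs_int, hs_val] at key
    have : ∫ v, a.alloc v i ∂M.valueLaw = q := rfl
    rw [this, sub_self, mul_zero] at key
    linarith [show M.virtualSurplus a i
      = ∫ v, (M.dist i).extVirtualValue (v i) * a.alloc v i ∂M.valueLaw from rfl]
  -- For `q = 1` the price need not lie in `reached`, but then the bidder almost surely wins and
  -- almost surely exceeds it.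
  · refine le_of_eq (integral_congr_ae ?_)
    have h1 : (fun v => 1 - a.alloc v i) =ᵐ[M.valueLaw] 0 := by
      refine (integral_eq_zero_iff_of_nonneg_ae ?_
        ((integrable_const _).sub (integrable_alloc a i))).1 ?_
      · filter_upwards [M.ae_nonneg] with v hv using sub_nonneg.2 (a.alloc_le_one hv i)
      · rw [integral_sub' (integrable_const _) (integrable_alloc a i)]
        have h' : ∫ v, a.alloc v i ∂M.valueLaw = 1 := hq1'
        simp [h']
    have h2 : (fun v => 1 - s (v i)) =ᵐ[M.valueLaw] 0 := by
      refine (integral_eq_zero_iff_of_nonneg (fun v => ?_) ((integrable_const _).sub hs_int)).1 ?_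
      · by_cases h : v i ∈ Set.Ioi ρ <;> simp [hs, h]
      · rw [integral_sub' (integrable_const _) hs_int, hs_val, hq1']
        simp
    filter_upwards [h1, h2] with v hx hs'
    simp only [Pi.zero_apply, sub_eq_zero] at hx hs'
    have hv : v i ∈ Set.Ioi ρ := by
      by_contra h
      simp [hs, h] at hs'
    rw [Set.indicator_of_mem hv, ← hx, mul_one]

end AdMDP

/-! ### Second-price and two-stage auctions as mechanisms -/

section SecondPriceLemmas

variable {n : ℕ} {S : Finset (Fin n)} {r : Fin n → ℝ≥0∞} {b : Fin n → ℝ} {i j : Fin n}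

theorem mem_eligible : i ∈ eligible S r b ↔ i ∈ S ∧ r i ≤ ENNReal.ofReal (b i) :=
  Finset.mem_filter

theorem SpaWins.mem (h : SpaWins S r b i) : i ∈ S := (mem_eligible.1 h.1).1

theorem SpaWins.unique (hi : SpaWins S r b i) (hj : SpaWins S r b j) : i = j := by
  by_contra h
  rcases hi.2 j hj.1 (Ne.symm h) with h1 | h1 <;> rcases hj.2 i hi.1 h with h2 | h2
  · exact lt_asymm h1 h2
  · exact h1.ne' h2.1
  · exact h2.ne' h1.1
  · exact lt_asymm h1.2 h2.2

theorem exists_spaWins (h : (eligible S r b).Nonempty) : ∃ i, SpaWins S r b i := by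
  obtain ⟨i, hi, hmax⟩ := Finset.exists_max_image (eligible S r b)
    (fun i => toLex (b i, OrderDual.toDual i)) h
  exact ⟨i, hi, fun j hj hji => (Prod.Lex.le_iff.1 (hmax j hj)).imp_right fun h =>
    ⟨h.1, lt_of_le_of_ne (OrderDual.toDual_le_toDual.1 h.2) hji.symm⟩⟩

theorem spaAlloc_nonneg (S : Finset (Fin n)) (r : Fin n → ℝ≥0∞) (b : Fin n → ℝ) (i : Fin n) :
    0 ≤ spaAlloc S r b i := by
  unfold spaAlloc; split_ifs <;> simp

theorem spaAlloc_of_notMem (h : i ∉ S) : spaAlloc S r b i = 0 :=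
  if_neg fun h' => h h'.mem

theorem spaPay_of_notMem (h : i ∉ S) : spaPay S r b i = 0 :=
  if_neg fun h' => h h'.mem

theorem spaPay_nonneg (S : Finset (Fin n)) (r : Fin n → ℝ≥0∞) (b : Fin n → ℝ) (i : Fin n) :
    0 ≤ spaPay S r b i := by
  unfold spaPay; split_ifs
  · exact le_max_of_le_left ENNReal.toReal_nonneg
  · exact le_rfl

open Classical in
theorem sum_spaAlloc (S : Finset (Fin n)) (r : Fin n → ℝ≥0∞) (b : Fin n → ℝ) :
    ∑ i, spaAlloc S r b i = if eligible S r b = ∅ then 0 else 1 := by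
  split_ifs with h
  · exact Finset.sum_eq_zero fun i _ => if_neg fun h' => by simpa [h] using h'.1
  · obtain ⟨i, hi⟩ := exists_spaWins (Finset.nonempty_iff_ne_empty.2 h)
    rw [Finset.sum_eq_single i]
    · exact if_pos hi
    · exact fun j _ hj => if_neg fun h' => hj (h'.unique hi)
    · simp

theorem eligible_update_erase (S : Finset (Fin n)) (r : Fin n → ℝ≥0∞) (b : Fin n → ℝ) (i : Fin n)
    (z : ℝ) : (eligible S r (Function.update b i z)).erase i = (eligible S r b).erase i := by
  ext j
  simp only [Finset.mem_erase, mem_eligible]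
  refine and_congr_right fun hj => ?_
  rw [Function.update_of_ne hj]

theorem eligible_update_of_notMem (h : i ∉ S) (z : ℝ) :
    eligible S r (Function.update b i z) = eligible S r b := by
  ext j
  simp only [mem_eligible]
  refine and_congr_right fun hj => ?_
  rw [Function.update_of_ne (ne_of_mem_of_not_mem hj h)]

/-- The price that bidder `i` has to beat in the second-price auction. -/
noncomputable def spaPrice (S : Finset (Fin n)) (r : Fin n → ℝ≥0∞) (b : Fin n → ℝ) (i : Fin n) :
    ℝ :=
  max (r i).toReal ((((eligible S r b).erase i).sup fun j => (b j).toNNReal : ℝ≥0) : ℝ)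

theorem spaPrice_update (S : Finset (Fin n)) (r : Fin n → ℝ≥0∞) (b : Fin n → ℝ) (i : Fin n)
    (z : ℝ) : spaPrice S r (Function.update b i z) i = spaPrice S r b i := by
  unfold spaPrice
  rw [eligible_update_erase, Finset.sup_congr rfl fun j hj => ?_]
  rw [Function.update_of_ne (Finset.ne_of_mem_erase hj)]

theorem SpaWins.spaPrice_le (h : SpaWins S r b i) (hb : 0 ≤ b) : spaPrice S r b i ≤ b i := by
  refine max_le (ENNReal.toReal_le_of_le_ofReal (hb i) (mem_eligible.1 h.1).2) ?_
  rw [← NNReal.coe_mk (b i) (hb i), NNReal.coe_le_coe]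
  refine Finset.sup_le fun j hj => ?_
  rw [Real.toNNReal_le_iff_le_coe]
  exact (h.2 j (Finset.mem_of_mem_erase hj) (Finset.ne_of_mem_erase hj)).elim le_of_lt
    fun h => h.1.le

theorem le_spaPrice (hj : j ∈ eligible S r b) (hji : j ≠ i) : b j ≤ spaPrice S r b i := by
  refine le_max_of_le_right ((Real.le_coe_toNNReal _).trans (NNReal.coe_le_coe.2 ?_))
  exact Finset.le_sup (f := fun j => (b j).toNNReal) (Finset.mem_erase.2 ⟨hji, hj⟩)

theorem spaWins_of_spaPrice_lt (hi : i ∈ S) (hr : r i ≠ ∞) (h : spaPrice S r b i < b i) :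
    SpaWins S r b i := by
  refine ⟨mem_eligible.2 ⟨hi, ?_⟩, fun j hj hji => Or.inl ((le_spaPrice hj hji).trans_lt h)⟩
  rw [← ENNReal.ofReal_toReal hr]
  exact ENNReal.ofReal_le_ofReal ((le_max_left _ _).trans h.le)

theorem spa_utility_eq (z : ℝ) (S : Finset (Fin n)) (r : Fin n → ℝ≥0∞) (b : Fin n → ℝ)
    (i : Fin n) : z * spaAlloc S r b i - spaPay S r b i
      = spaAlloc S r b i * (z - spaPrice S r b i) := by
  unfold spaAlloc spaPay
  split_ifs
  · rw [mul_one, one_mul]; rfl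
  · simp

theorem spa_individually_rational (hb : 0 ≤ b) (S : Finset (Fin n)) (r : Fin n → ℝ≥0∞)
    (i : Fin n) : 0 ≤ b i * spaAlloc S r b i - spaPay S r b i := by
  rw [spa_utility_eq]
  unfold spaAlloc
  split_ifs with h
  · simpa using h.spaPrice_le hb
  · simp

/-- A winner's utility is value minus `spaPrice`, which does not depend on the own bid. A value
strictly above it wins truthfully; at equality winning is worth zero, so ties are harmless. -/
theorem spa_incentive_compatible (hb : 0 ≤ b) (S : Finset (Fin n)) (r : Fin n → ℝ≥0∞)
    (i : Fin n) (z : ℝ) :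
    b i * spaAlloc S r (Function.update b i z) i - spaPay S r (Function.update b i z) i
      ≤ b i * spaAlloc S r b i - spaPay S r b i := by
  by_cases hw : SpaWins S r (Function.update b i z) i
  · rcases le_or_gt (b i) (spaPrice S r b i) with h | h
    · refine le_trans ?_ (spa_individually_rational hb S r i)
      rw [spa_utility_eq, spaPrice_update]
      exact mul_nonpos_of_nonneg_of_nonpos (spaAlloc_nonneg _ _ _ _) (by linarith)
    · have hr : r i ≠ ∞ := ne_top_of_le_ne_top ENNReal.ofReal_ne_top (mem_eligible.1 hw.1).2
      have hw' := spaWins_of_spaPrice_lt hw.mem hr h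
      rw [spa_utility_eq, spa_utility_eq, spaPrice_update, spaAlloc, spaAlloc, if_pos hw,
        if_pos hw']
  · rw [spa_utility_eq, spaAlloc, if_neg hw, zero_mul]
    exact spa_individually_rational hb S r i

/-- The revenue of the second-price auction is at least the reserve of every eligible bidder. -/
theorem le_sum_spaPay (hb : 0 ≤ b) (hj : j ∈ eligible S r b) :
    (r j).toReal ≤ ∑ i, spaPay S r b i := by
  obtain ⟨i, hi⟩ := exists_spaWins ⟨j, hj⟩
  refine le_trans ?_ (Finset.single_le_sum (fun i _ => spaPay_nonneg S r b i) (Finset.mem_univ i))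
  rw [spaPay, if_pos hi]
  rcases eq_or_ne j i with rfl | hji
  · exact le_max_left _ _
  · exact (ENNReal.toReal_le_of_le_ofReal (hb j) (mem_eligible.1 hj).2).trans (le_spaPrice hj hji)

theorem measurableSet_mem_eligible (S : Finset (Fin n)) (i : Fin n) :
    MeasurableSet {p : (Fin n → ℝ≥0∞) × (Fin n → ℝ) | i ∈ eligible S p.1 p.2} := by
  simp_rw [mem_eligible]
  exact (MeasurableSet.const _).inter (measurableSet_le ((measurable_pi_apply i).comp measurable_fst)
    ((measurable_pi_apply i).comp measurable_snd).ennreal_ofReal)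

theorem measurableSet_spaWins (S : Finset (Fin n)) (i : Fin n) :
    MeasurableSet {p : (Fin n → ℝ≥0∞) × (Fin n → ℝ) | SpaWins S p.1 p.2 i} := by
  have hm : ∀ j, Measurable fun p : (Fin n → ℝ≥0∞) × (Fin n → ℝ) => p.2 j := fun j =>
    (measurable_pi_apply j).comp measurable_snd
  refine (measurableSet_mem_eligible S i).inter ?_
  refine MeasurableSet.congr (s := ⋂ j, {p : (Fin n → ℝ≥0∞) × (Fin n → ℝ) |
    j ∈ eligible S p.1 p.2 → j ≠ i → p.2 j < p.2 i ∨ (p.2 j = p.2 i ∧ i < j)}) ?_ ?_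
  · refine MeasurableSet.iInter fun j => ?_
    refine (measurableSet_mem_eligible S j).imp ((MeasurableSet.const _).imp ?_)
    exact (measurableSet_lt (hm j) (hm i)).union
      ((measurableSet_eq_fun (hm j) (hm i)).inter (.const _))
  · ext p
    rw [Set.mem_iInter]
    rfl

theorem measurable_spaAlloc (S : Finset (Fin n)) (i : Fin n) :
    Measurable fun p : (Fin n → ℝ≥0∞) × (Fin n → ℝ) => spaAlloc S p.1 p.2 i :=
  Measurable.ite (measurableSet_spaWins S i) measurable_const measurable_const

-- For measurability: the supremum over a set that varies with the bids becomes one over a fixed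
-- set.
open Classical in
theorem sup_eligible_eq (S : Finset (Fin n)) (r : Fin n → ℝ≥0∞) (b : Fin n → ℝ) (i : Fin n) :
    (((eligible S r b).erase i).sup fun j => (b j).toNNReal)
      = (Finset.univ.erase i).sup fun j => if j ∈ eligible S r b then (b j).toNNReal else 0 := by
  refine le_antisymm (Finset.sup_le fun j hj => ?_) (Finset.sup_le fun j hj => ?_)
  · rw [Finset.mem_erase] at hj
    refine le_trans (le_of_eq ?_) (Finset.le_sup (Finset.mem_erase.2 ⟨hj.1, Finset.mem_univ j⟩))
    rw [if_pos hj.2]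
  · split_ifs with h
    · exact Finset.le_sup (f := fun j => (b j).toNNReal)
        (Finset.mem_erase.2 ⟨Finset.ne_of_mem_erase hj, h⟩)
    · exact zero_le

theorem measurable_finset_sup {α ι : Type*} [MeasurableSpace α] (s : Finset ι)
    {f : ι → α → ℝ≥0} (hf : ∀ i, Measurable (f i)) : Measurable fun a => s.sup fun i => f i a := by
  classical
  induction s using Finset.induction_on with
  | empty => simp
  | insert i s _ ih =>
    simp_rw [Finset.sup_insert]
    exact (hf i).sup ih

theorem measurable_spaPay (S : Finset (Fin n)) (i : Fin n) :
    Measurable fun p : (Fin n → ℝ≥0∞) × (Fin n → ℝ) => spaPay S p.1 p.2 i := by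
  refine Measurable.ite (measurableSet_spaWins S i) ?_ measurable_const
  refine ((measurable_pi_apply i).comp measurable_fst).ennreal_toReal.max
    (Measurable.coe_nnreal_real ?_)
  simp_rw [sup_eligible_eq]
  refine measurable_finset_sup _ fun j => ?_
  exact Measurable.ite (measurableSet_mem_eligible S j)
    ((measurable_pi_apply j).comp measurable_snd).real_toNNReal measurable_const

theorem measurable_spaAlloc_right (S : Finset (Fin n)) (r : Fin n → ℝ≥0∞) (i : Fin n) :
    Measurable fun b : Fin n → ℝ => spaAlloc S r b i := by
  have h := (measurable_spaAlloc S i).comp (measurable_prodMk_left (x := r))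
  exact h

theorem measurable_spaPay_right (S : Finset (Fin n)) (r : Fin n → ℝ≥0∞) (i : Fin n) :
    Measurable fun b : Fin n → ℝ => spaPay S r b i := by
  have h := (measurable_spaPay S i).comp (measurable_prodMk_left (x := r))
  exact h

open Classical in
/-- The indicator of the event that no bidder in `S` is eligible. -/
noncomputable def noneEligible (S : Finset (Fin n)) (r : Fin n → ℝ≥0∞) (b : Fin n → ℝ) : ℝ :=
  if eligible S r b = ∅ then 1 else 0

theorem noneEligible_nonneg (S : Finset (Fin n)) (r : Fin n → ℝ≥0∞) (b : Fin n → ℝ) :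
    0 ≤ noneEligible S r b := by
  unfold noneEligible; split_ifs <;> simp

theorem noneEligible_eq (S : Finset (Fin n)) (r : Fin n → ℝ≥0∞) (b : Fin n → ℝ) :
    noneEligible S r b = 1 - ∑ i, spaAlloc S r b i := by
  rw [sum_spaAlloc, noneEligible]
  split_ifs <;> simp

theorem sum_spaAlloc_le_one (S : Finset (Fin n)) (r : Fin n → ℝ≥0∞) (b : Fin n → ℝ) :
    ∑ i, spaAlloc S r b i ≤ 1 := by
  linarith [noneEligible_eq S r b, noneEligible_nonneg S r b]

theorem measurable_noneEligible (S : Finset (Fin n)) :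
    Measurable fun p : (Fin n → ℝ≥0∞) × (Fin n → ℝ) => noneEligible S p.1 p.2 := by
  simp_rw [noneEligible_eq]
  exact measurable_const.sub (Finset.measurable_sum _ fun i _ => measurable_spaAlloc S i)

/-- The two-stage auction with constant reserves. -/
def TwoStage.ofReserves (S : Finset (Fin n)) (r : Fin n → ℝ≥0∞) (θ : unitInterval) :
    TwoStage n where
  S₁ := S
  reserve _ := r
  measurable_reserve := measurable_const
  dependsOn_reserve := fun _ _ _ => rfl
  θ := θ
  θ_nonneg := θ.2.1
  θ_le_one := θ.2.2

/-- The allocation rule of the two-stage auction with constant reserves. -/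
noncomputable def twoStageAlloc (S : Finset (Fin n)) (r : Fin n → ℝ≥0∞) (θ : ℝ) (b : Fin n → ℝ)
    (i : Fin n) : ℝ :=
  spaAlloc S r b i + noneEligible S r b * θ * spaAlloc Sᶜ 0 b i

/-- The payments of the two-stage auction with constant reserves. -/
noncomputable def twoStagePay (S : Finset (Fin n)) (r : Fin n → ℝ≥0∞) (θ : ℝ) (b : Fin n → ℝ)
    (i : Fin n) : ℝ :=
  spaPay S r b i + noneEligible S r b * θ * spaPay Sᶜ 0 b i

theorem measurable_noneEligible_params (S : Finset (Fin n)) :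
    Measurable fun p : ((Fin n → ℝ≥0∞) × ℝ) × (Fin n → ℝ) => noneEligible S p.1.1 p.2 := by
  have h1 : Measurable fun p : ((Fin n → ℝ≥0∞) × ℝ) × (Fin n → ℝ) => (p.1.1, p.2) :=
    (measurable_fst.comp measurable_fst).prodMk measurable_snd
  have h := (measurable_noneEligible S).comp h1
  exact h

theorem measurable_spaAlloc_params (S : Finset (Fin n)) (i : Fin n) :
    Measurable fun p : ((Fin n → ℝ≥0∞) × ℝ) × (Fin n → ℝ) => spaAlloc S p.1.1 p.2 i := by
  have h1 : Measurable fun p : ((Fin n → ℝ≥0∞) × ℝ) × (Fin n → ℝ) => (p.1.1, p.2) :=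
    (measurable_fst.comp measurable_fst).prodMk measurable_snd
  have h := (measurable_spaAlloc S i).comp h1
  exact h

theorem measurable_spaAlloc_zero (S : Finset (Fin n)) (i : Fin n) :
    Measurable fun p : ((Fin n → ℝ≥0∞) × ℝ) × (Fin n → ℝ) => spaAlloc S 0 p.2 i := by
  have hs : Measurable fun p : ((Fin n → ℝ≥0∞) × ℝ) × (Fin n → ℝ) => p.2 := measurable_snd
  have h := (measurable_spaAlloc_right S 0 i).comp hs
  exact h

theorem measurable_twoStageAlloc (S : Finset (Fin n)) (i : Fin n) :
    Measurable fun p : ((Fin n → ℝ≥0∞) × ℝ) × (Fin n → ℝ) => twoStageAlloc S p.1.1 p.1.2 p.2 i := by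
  unfold twoStageAlloc
  exact (measurable_spaAlloc_params S i).add (((measurable_noneEligible_params S).mul
    (measurable_snd.comp measurable_fst)).mul (measurable_spaAlloc_zero Sᶜ i))

theorem measurable_spaPay_params (S : Finset (Fin n)) (i : Fin n) :
    Measurable fun p : ((Fin n → ℝ≥0∞) × ℝ) × (Fin n → ℝ) => spaPay S p.1.1 p.2 i := by
  have h1 : Measurable fun p : ((Fin n → ℝ≥0∞) × ℝ) × (Fin n → ℝ) => (p.1.1, p.2) :=
    (measurable_fst.comp measurable_fst).prodMk measurable_snd
  have h := (measurable_spaPay S i).comp h1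
  exact h

theorem measurable_spaPay_zero (S : Finset (Fin n)) (i : Fin n) :
    Measurable fun p : ((Fin n → ℝ≥0∞) × ℝ) × (Fin n → ℝ) => spaPay S 0 p.2 i := by
  have hs : Measurable fun p : ((Fin n → ℝ≥0∞) × ℝ) × (Fin n → ℝ) => p.2 := measurable_snd
  have h := (measurable_spaPay_right S 0 i).comp hs
  exact h

theorem measurable_twoStagePay (S : Finset (Fin n)) (i : Fin n) :
    Measurable fun p : ((Fin n → ℝ≥0∞) × ℝ) × (Fin n → ℝ) => twoStagePay S p.1.1 p.1.2 p.2 i := by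
  unfold twoStagePay
  exact (measurable_spaPay_params S i).add (((measurable_noneEligible_params S).mul
    (measurable_snd.comp measurable_fst)).mul (measurable_spaPay_zero Sᶜ i))

theorem twoStage_utility_eq (z : ℝ) (S : Finset (Fin n)) (r : Fin n → ℝ≥0∞) (θ : ℝ)
    (b : Fin n → ℝ) (i : Fin n) :
    z * twoStageAlloc S r θ b i - twoStagePay S r θ b i
      = (z * spaAlloc S r b i - spaPay S r b i)
        + noneEligible S r b * θ * (z * spaAlloc Sᶜ 0 b i - spaPay Sᶜ 0 b i) := by
  unfold twoStageAlloc twoStagePay; ring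

/-- The two-stage auction with constant reserves, as a mechanism. -/
noncomputable def twoStageMech (S : Finset (Fin n)) (r : Fin n → ℝ≥0∞) (θ : unitInterval) :
    Mechanism n where
  alloc := twoStageAlloc S r θ
  pay := twoStagePay S r θ
  measurable_alloc := measurable_pi_lambda _ fun i => by
    have h := (measurable_twoStageAlloc S i).comp (measurable_prodMk_left (x := (r, (θ : ℝ))))
    exact h
  measurable_pay := measurable_pi_lambda _ fun i => by
    have h := (measurable_twoStagePay S i).comp (measurable_prodMk_left (x := (r, (θ : ℝ))))
    exact h
  alloc_nonneg b _ i := by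
    unfold twoStageAlloc
    exact add_nonneg (spaAlloc_nonneg _ _ _ _)
      (mul_nonneg (mul_nonneg (noneEligible_nonneg _ _ _) θ.2.1) (spaAlloc_nonneg _ _ _ _))
  sum_alloc_le_one b _ := by
    unfold twoStageAlloc
    rw [Finset.sum_add_distrib, ← Finset.mul_sum, noneEligible_eq]
    have h1 := sum_spaAlloc_le_one S r b
    have h2 : (θ : ℝ) * ∑ i, spaAlloc Sᶜ 0 b i ≤ 1 := mul_le_one₀ θ.2.2
      (Finset.sum_nonneg fun i _ => spaAlloc_nonneg _ _ _ _) (sum_spaAlloc_le_one _ _ _)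
    nlinarith
  pay_nonneg b _ i := by
    unfold twoStagePay
    exact add_nonneg (spaPay_nonneg _ _ _ _)
      (mul_nonneg (mul_nonneg (noneEligible_nonneg _ _ _) θ.2.1) (spaPay_nonneg _ _ _ _))
  incentive_compatible v hv i b hb := by
    rw [twoStage_utility_eq, twoStage_utility_eq]
    refine add_le_add (spa_incentive_compatible hv S r i b) ?_
    -- A bidder of `S` gets nothing in the second stage, and a bidder outside `S` cannot influence
    -- whether that stage is reached.
    by_cases hi : i ∈ S
    · have hi' : i ∉ Sᶜ := by simpa using hi
      simp [spaAlloc_of_notMem hi', spaPay_of_notMem hi']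
    · rw [noneEligible, noneEligible, eligible_update_of_notMem hi]
      exact mul_le_mul_of_nonneg_left (spa_incentive_compatible hv Sᶜ 0 i b)
        (mul_nonneg (noneEligible_nonneg S r v) θ.2.1)
  individually_rational v hv i := by
    rw [twoStage_utility_eq]
    exact add_nonneg (spa_individually_rational hv S r i)
      (mul_nonneg (mul_nonneg (noneEligible_nonneg S r v) θ.2.1)
        (spa_individually_rational hv Sᶜ 0 i))

theorem noWinnerProb_ofReserves (M : AdMDP n) (S : Finset (Fin n)) (r : Fin n → ℝ≥0∞)
    (θ : unitInterval) (b : Fin n → ℝ) :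
    (TwoStage.ofReserves S r θ).noWinnerProb M.valueLaw b = noneEligible S r b := by
  change ∫ _, noneEligible S r b ∂M.valueLaw = _
  simp

theorem isTwoStage_twoStageMech (M : AdMDP n) (S : Finset (Fin n)) (r : Fin n → ℝ≥0∞)
    (θ : unitInterval) :
    M.IsTwoStage (twoStageMech S r θ) (TwoStage.ofReserves S r θ) := by
  intro b _
  constructor <;> ext i
  · change twoStageAlloc S r θ b i = ∫ _, spaAlloc S r b i ∂M.valueLaw
      + (TwoStage.ofReserves S r θ).noWinnerProb M.valueLaw b * θ * spaAlloc Sᶜ 0 b i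
    rw [noWinnerProb_ofReserves]
    simp [twoStageAlloc]
  · change twoStagePay S r θ b i = ∫ _, spaPay S r b i ∂M.valueLaw
      + (TwoStage.ofReserves S r θ).noWinnerProb M.valueLaw b * θ * spaPay Sᶜ 0 b i
    rw [noWinnerProb_ofReserves]
    simp [twoStagePay]

end SecondPriceLemmas

namespace AdMDP

variable {n : ℕ}

/-- The policy that runs, in every state, the two-stage auction with first stage among `S`, with
reserves and second-stage probability depending measurably on the state. -/
noncomputable def twoStagePolicy (M : AdMDP n) (S : Finset (Fin n))
    (r : unitInterval → Fin n → ℝ≥0∞) (hr : Measurable r) (θ : unitInterval → unitInterval)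
    (hθ : Measurable θ) : M.Policy where
  mech ctr := twoStageMech S (r ctr) (θ ctr)
  measurable_showProb := measurable_showProb_of fun i => measurable_winProb_of <| by
    have h := (measurable_twoStageAlloc S i).comp (((hr.comp measurable_fst).prodMk
      (measurable_subtype_coe.comp (hθ.comp measurable_fst))).prodMk
        (measurable_snd (α := unitInterval) (β := Fin n → ℝ)))
    exact h
  measurable_expectedPayment := by
    unfold expectedPayment
    refine Measurable.lintegral_prod_right' (f := fun p : unitInterval × (Fin n → ℝ) =>
      ENNReal.ofReal (∑ i, (twoStageMech S (r p.1) (θ p.1)).pay p.2 i)) ?_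
    refine (Finset.measurable_sum _ fun i _ => ?_).ennreal_ofReal
    have h := (measurable_twoStagePay S i).comp (((hr.comp measurable_fst).prodMk
      (measurable_subtype_coe.comp (hθ.comp measurable_fst))).prodMk
        (measurable_snd (α := unitInterval) (β := Fin n → ℝ)))
    exact h

end AdMDP

/-! ### Sale probabilities and revenue with independent reserve events -/

theorem one_sub_sum_le_prod_one_sub {ι : Type*} (s : Finset ι) {q : ι → ℝ}
    (h0 : ∀ i ∈ s, 0 ≤ q i) (h1 : ∀ i ∈ s, q i ≤ 1) :
    1 - ∑ i ∈ s, q i ≤ ∏ i ∈ s, (1 - q i) := by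
  classical
  induction s using Finset.induction_on with
  | empty => simp
  | insert i s hi ih =>
    rw [Finset.sum_insert hi, Finset.prod_insert hi]
    have ih := ih (fun j hj => h0 j (Finset.mem_insert_of_mem hj))
      fun j hj => h1 j (Finset.mem_insert_of_mem hj)
    have hs : 0 ≤ ∑ j ∈ s, q j := Finset.sum_nonneg fun j hj => h0 j (Finset.mem_insert_of_mem hj)
    nlinarith [h0 i (Finset.mem_insert_self i s), h1 i (Finset.mem_insert_self i s)]

open Classical in
/-- A truncated inclusion-exclusion bound for the maximum of the active terms. -/
theorem sum_mul_one_sub_half_le {ι : Type*} [DecidableEq ι] (s : Finset ι) (A : ι → Prop)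
    {x : ι → ℝ} (hx : ∀ i ∈ s, 0 ≤ x i) {Y : ℝ} (hY : 0 ≤ Y) (hxY : ∀ i ∈ s, A i → x i ≤ Y) :
    ∑ j ∈ s, x j * ((if A j then 1 else 0)
      - (∑ l ∈ s.erase j, if A j ∧ A l then 1 else 0) / 2) ≤ Y := by
  have h1 : ∑ j ∈ s, x j * ((if A j then (1 : ℝ) else 0)
        - (∑ l ∈ s.erase j, if A j ∧ A l then 1 else 0) / 2)
      = ∑ j ∈ s with A j, x j * ((3 - (s.filter A).card) / 2) := by
    rw [Finset.sum_filter]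
    refine Finset.sum_congr rfl fun j hj => ?_
    by_cases hA : A j
    · have h2 : (∑ l ∈ s.erase j, if A j ∧ A l then (1 : ℝ) else 0) = (s.filter A).card - 1 := by
        simp only [hA, true_and]
        rw [← Finset.sum_boole, ← Finset.add_sum_erase s _ hj, if_pos hA]
        ring
      rw [h2, if_pos hA, if_pos hA]
      ring
    · simp [hA]
  -- With `N` active terms each has coefficient `(3 - N) / 2`: one term counts fully, two are
  -- averaged, and from three on the coefficient is not positive.
  rw [h1, ← Finset.sum_mul]
  have h3 : ∑ j ∈ s with A j, x j ≤ (s.filter A).card * Y := by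
    rw [← nsmul_eq_mul]
    exact Finset.sum_le_card_nsmul _ _ _ fun j hj =>
      hxY j (Finset.mem_of_mem_filter j hj) (Finset.mem_filter.1 hj).2
  have h4 : 0 ≤ ∑ j ∈ s with A j, x j :=
    Finset.sum_nonneg fun j hj => hx j (Finset.mem_of_mem_filter j hj)
  generalize (s.filter A).card = N at *
  rcases Nat.lt_or_ge N 3 with hN | hN
  · interval_cases N <;> push_cast at * <;> nlinarith
  · have : (3 : ℝ) ≤ N := by exact_mod_cast hN
    nlinarith

namespace AdMDP

variable {n : ℕ} {M : AdMDP n}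

theorem valueLaw_pi (T : Finset (Fin n)) (A : Fin n → Set ℝ) :
    M.valueLaw {v | ∀ i ∈ T, v i ∈ A i} = ∏ i ∈ T, (M.dist i).law (A i) := by
  classical
  have h : {v : Fin n → ℝ | ∀ i ∈ T, v i ∈ A i}
      = Set.pi Set.univ fun i => if i ∈ T then A i else Set.univ := by
    ext v
    simp only [Set.mem_univ_pi]
    refine forall_congr' fun i => ?_
    by_cases hi : i ∈ T <;> simp [hi]
  rw [h, valueLaw, Measure.pi_pi]
  rw [← Finset.prod_subset (Finset.subset_univ T) fun i _ hi => by simp [hi]]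
  exact Finset.prod_congr rfl fun i hi => by rw [if_pos hi]

/-- The reserves that bidder `i` meets with probability `p i`. -/
noncomputable def reserves (M : AdMDP n) (p : Fin n → ℝ) (i : Fin n) : ℝ≥0∞ :=
  (M.dist i).reserveAt (p i)

/-- The bids that meet the reserve. -/
def meets (M : AdMDP n) (p : Fin n → ℝ) (i : Fin n) : Set ℝ :=
  {y | M.reserves p i ≤ ENNReal.ofReal y}

theorem measurableSet_meets (p : Fin n → ℝ) (i : Fin n) : MeasurableSet (M.meets p i) :=
  measurableSet_le measurable_const ENNReal.measurable_ofReal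

theorem measurableSet_forall_mem (T : Finset (Fin n)) {A : Fin n → Set ℝ}
    (hA : ∀ i, MeasurableSet (A i)) : MeasurableSet {v : Fin n → ℝ | ∀ i ∈ T, v i ∈ A i} := by
  have : {v : Fin n → ℝ | ∀ i ∈ T, v i ∈ A i} = Set.pi T A := rfl
  rw [this]
  exact MeasurableSet.pi T.countable_toSet fun i _ => hA i

variable {p : Fin n → ℝ}

theorem measureReal_forall_meets (hp0 : ∀ i, 0 ≤ p i) (hp1 : ∀ i, p i ≤ 1)
    (T : Finset (Fin n)) :
    M.valueLaw.real {v | ∀ i ∈ T, v i ∈ M.meets p i} = ∏ i ∈ T, p i := by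
  rw [measureReal_def, valueLaw_pi, ENNReal.toReal_prod]
  refine Finset.prod_congr rfl fun i _ => ?_
  exact (congrArg ENNReal.toReal ((M.dist i).law_reserveAt_le (hp0 i) (hp1 i))).trans
    (ENNReal.toReal_ofReal (hp0 i))

theorem integral_noneEligible (hp0 : ∀ i, 0 ≤ p i) (hp1 : ∀ i, p i ≤ 1)
    (S : Finset (Fin n)) :
    ∫ v, noneEligible S (M.reserves p) v ∂M.valueLaw = ∏ i ∈ S, (1 - p i) := by
  classical
  have hset : ∀ v : Fin n → ℝ, noneEligible S (M.reserves p) v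
      = {v : Fin n → ℝ | ∀ i ∈ S, v i ∈ (M.meets p i)ᶜ}.indicator 1 v := by
    intro v
    have : eligible S (M.reserves p) v = ∅ ↔ ∀ i ∈ S, v i ∈ (M.meets p i)ᶜ := by
      simp only [Finset.eq_empty_iff_forall_notMem, mem_eligible, not_and]
      rfl
    rw [noneEligible, Set.indicator_apply]
    exact if_congr this rfl rfl
  simp_rw [hset]
  rw [integral_indicator_one (measurableSet_forall_mem S fun i => (measurableSet_meets p i).compl),
    measureReal_def, valueLaw_pi, ENNReal.toReal_prod]
  refine Finset.prod_congr rfl fun i _ => ?_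
  rw [prob_compl_eq_one_sub (measurableSet_meets p i)]
  have h : (M.dist i).law (M.meets p i) = ENNReal.ofReal (p i) :=
    (M.dist i).law_reserveAt_le (hp0 i) (hp1 i)
  rw [h, ← ENNReal.ofReal_one, ← ENNReal.ofReal_sub _ (hp0 i),
    ENNReal.toReal_ofReal (by linarith [hp1 i])]

/-- The first stage sells exactly when some bidder of `S` meets the reserve. Only the total is
computed; how it splits among `S` is irrelevant to the transitions. -/
theorem sum_winProb_twoStageMech_first (hp0 : ∀ i, 0 ≤ p i) (hp1 : ∀ i, p i ≤ 1)
    (S : Finset (Fin n)) (θ : unitInterval) :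
    ∑ i ∈ S, M.winProb (twoStageMech S (M.reserves p) θ) i = 1 - ∏ i ∈ S, (1 - p i) := by
  unfold winProb
  rw [← integral_finsetSum _ fun i _ => integrable_alloc _ i, ← integral_noneEligible (M := M) hp0 hp1]
  have h : ∀ v, ∑ i ∈ S, (twoStageMech S (M.reserves p) θ).alloc v i
      = 1 - noneEligible S (M.reserves p) v := by
    intro v
    change ∑ i ∈ S, twoStageAlloc S (M.reserves p) θ v i = _
    rw [noneEligible_eq, sub_sub_cancel,
      ← Finset.sum_subset (Finset.subset_univ S) fun i _ hi => spaAlloc_of_notMem hi]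
    refine Finset.sum_congr rfl fun i hi => ?_
    rw [twoStageAlloc, spaAlloc_of_notMem (S := Sᶜ) (by simpa using hi), mul_zero, add_zero]
  simp_rw [h]
  rw [integral_sub (integrable_const _), integral_const]
  · simp
  · refine (integrable_const (1 : ℝ)).mono' ?_ (.of_forall fun v => ?_)
    · have hm := (measurable_noneEligible S).comp (measurable_prodMk_left (x := M.reserves p))
      exact hm.aestronglyMeasurable
    · unfold noneEligible
      split_ifs <;> simp

theorem sum_winProb_twoStageMech_second (hp0 : ∀ i, 0 ≤ p i) (hp1 : ∀ i, p i ≤ 1)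
    (S : Finset (Fin n)) (hS : Sᶜ.Nonempty)
    (θ : unitInterval) :
    ∑ i ∈ Sᶜ, M.winProb (twoStageMech S (M.reserves p) θ) i = θ * ∏ i ∈ S, (1 - p i) := by
  unfold winProb
  rw [← integral_finsetSum _ fun i _ => integrable_alloc _ i, ← integral_noneEligible (M := M) hp0 hp1,
    ← integral_const_mul]
  refine integral_congr_ae (.of_forall fun v => ?_)
  change ∑ i ∈ Sᶜ, twoStageAlloc S (M.reserves p) θ v i = θ * noneEligible S (M.reserves p) v
  have h1 : ∑ i ∈ Sᶜ, spaAlloc Sᶜ 0 v i = 1 := by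
    rw [Finset.sum_subset (Finset.subset_univ _) fun i _ hi => spaAlloc_of_notMem hi,
      sum_spaAlloc, if_neg]
    obtain ⟨i, hi⟩ := hS
    exact Finset.ne_empty_of_mem (mem_eligible.2 ⟨hi, zero_le⟩)
  unfold twoStageAlloc
  rw [Finset.sum_add_distrib, ← Finset.mul_sum, h1,
    Finset.sum_eq_zero fun i hi => spaAlloc_of_notMem (Finset.mem_compl.1 hi)]
  ring

/-- Revenue is at least every reserve that is met. Truncated inclusion-exclusion and pairwise
independence bound it below by the sum of `x j * p j * (1 - (∑ l ∈ S'.erase j, p l) / 2)`, whose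
last factor is at least 1/2. The subset `S'` allows the adjusted bidder to be left out, since that
bidder may push the sum of the probabilities above one. -/
theorem half_sum_reserve_mul_le (hp0 : ∀ i, 0 ≤ p i) (hp1 : ∀ i, p i ≤ 1)
    (S S' : Finset (Fin n)) (hS : S' ⊆ S) (hsum : ∑ i ∈ S', p i ≤ 1)
    (θ : unitInterval) :
    ∑ j ∈ S', (M.reserves p j).toReal * p j
      ≤ 2 * ∑ i, M.meanPay (twoStageMech S (M.reserves p) θ) i := by
  classical
  set x : Fin n → ℝ := fun j => (M.reserves p j).toReal with hx
  have hx0 : ∀ j, 0 ≤ x j := fun j => ENNReal.toReal_nonneg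
  set I : Finset (Fin n) → (Fin n → ℝ) → ℝ :=
    fun T => {v | ∀ i ∈ T, v i ∈ M.meets p i}.indicator 1 with hI
  have hIm : ∀ T, MeasurableSet {v : Fin n → ℝ | ∀ i ∈ T, v i ∈ M.meets p i} := fun T =>
    measurableSet_forall_mem T (measurableSet_meets p)
  have hIint : ∀ T, Integrable (I T) M.valueLaw := fun T =>
    (integrable_const (1 : ℝ)).indicator (hIm T)
  have hIval : ∀ T, ∫ v, I T v ∂M.valueLaw = ∏ i ∈ T, p i := fun T => by
    rw [hI, integral_indicator_one (hIm T), measureReal_forall_meets hp0 hp1]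
  have hpt : ∀ᵐ v ∂M.valueLaw, ∑ j ∈ S', x j * (I {j} v - (∑ l ∈ S'.erase j, I {j, l} v) / 2)
      ≤ ∑ i, (twoStageMech S (M.reserves p) θ).pay v i := by
    filter_upwards [M.ae_nonneg] with v hv
    have hY : ∑ i, spaPay S (M.reserves p) v i
        ≤ ∑ i, (twoStageMech S (M.reserves p) θ).pay v i := by
      refine Finset.sum_le_sum fun i _ => ?_
      change _ ≤ twoStagePay S (M.reserves p) θ v i
      unfold twoStagePay
      exact le_add_of_nonneg_right (mul_nonneg (mul_nonneg (noneEligible_nonneg _ _ _) θ.2.1)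
        (spaPay_nonneg _ _ _ _))
    refine le_trans ?_ hY
    have := sum_mul_one_sub_half_le S' (fun i => v i ∈ M.meets p i) (fun i _ => hx0 i)
      (Finset.sum_nonneg fun i _ => spaPay_nonneg S (M.reserves p) v i)
      fun i hi hA => le_sum_spaPay hv (mem_eligible.2 ⟨hS hi, hA⟩)
    simpa [hI, Set.indicator_apply] using this
  have hterm : ∀ j, Integrable (fun v => x j * (I {j} v - (∑ l ∈ S'.erase j, I {j, l} v) / 2))
      M.valueLaw := fun j =>
    ((hIint _).sub ((integrable_finsetSum _ fun l _ => hIint _).div_const _)).const_mul _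
  have hmono := integral_mono_ae (integrable_finsetSum _ fun j _ => hterm j)
    (integrable_finsetSum _ fun i _ => integrable_pay _ i) hpt
  rw [integral_finsetSum _ fun j _ => hterm j,
    integral_finsetSum _ fun i _ => integrable_pay _ i] at hmono
  have hval : ∀ j, ∫ v, x j * (I {j} v - (∑ l ∈ S'.erase j, I {j, l} v) / 2) ∂M.valueLaw
      = x j * p j * (1 - (∑ l ∈ S'.erase j, p l) / 2) := by
    intro j
    rw [integral_const_mul, integral_sub (hIint _)
      ((integrable_finsetSum _ fun l _ => hIint _).div_const _), integral_div,
      integral_finsetSum _ fun l _ => hIint _, hIval, Finset.prod_singleton]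
    have : ∑ l ∈ S'.erase j, ∫ v, I {j, l} v ∂M.valueLaw = p j * ∑ l ∈ S'.erase j, p l := by
      rw [Finset.mul_sum]
      refine Finset.sum_congr rfl fun l hl => ?_
      rw [hIval, Finset.prod_pair (Finset.ne_of_mem_erase hl).symm]
    rw [this]
    ring
  simp_rw [hval] at hmono
  have hlow : ∑ j ∈ S', x j * p j ≤
      2 * ∑ j ∈ S', x j * p j * (1 - (∑ l ∈ S'.erase j, p l) / 2) := by
    rw [Finset.mul_sum]
    refine Finset.sum_le_sum fun j _ => ?_
    have h1 : ∑ l ∈ S'.erase j, p l ≤ 1 := (Finset.sum_le_sum_of_subset_of_nonneg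
      (Finset.erase_subset _ _) fun i _ _ => hp0 i).trans hsum
    nlinarith [mul_nonneg (hx0 j) (hp0 j)]
  refine hlow.trans (mul_le_mul_of_nonneg_left hmono zero_le_two)

end AdMDP

/-! ### Adjusting one reserve to match the showing probabilities -/

section Adjustment

variable {n : ℕ}

/-- Change the `k`-th entry of `q` so that the probability that some bidder in `S` meets the
reserve, when bidder `i` does with probability `q i`, becomes `∑ i ∈ S, q i`. -/
noncomputable def adjustAt (S : Finset (Fin n)) (k : Fin n) (q : Fin n → ℝ) : Fin n → ℝ :=
  Function.update q k (1 - (1 - ∑ i ∈ S, q i) / ∏ i ∈ S.erase k, (1 - q i))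

/-- The probability of running the second stage when the first has no winner, for which the bidders
outside `S` win with total probability `∑ i ∈ Sᶜ, q i`. -/
noncomputable def secondStageProb (S : Finset (Fin n)) (q : Fin n → ℝ) : unitInterval :=
  Set.projIcc 0 1 zero_le_one ((∑ i ∈ Sᶜ, q i) / (1 - ∑ i ∈ S, q i))

theorem measurable_adjustAt (S : Finset (Fin n)) (k : Fin n) : Measurable (adjustAt S k) := by
  refine measurable_pi_lambda _ fun j => ?_
  unfold adjustAt
  rcases eq_or_ne j k with rfl | hj
  · simp only [Function.update_self]
    fun_prop
  · simp only [Function.update_of_ne hj]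
    fun_prop

theorem measurable_secondStageProb (S : Finset (Fin n)) :
    Measurable (secondStageProb (n := n) S) := by
  refine continuous_projIcc.measurable.comp ?_
  fun_prop

variable {S : Finset (Fin n)} {k : Fin n} {q : Fin n → ℝ}

theorem le_one_of_sum_le_one (h0 : ∀ i, 0 ≤ q i) (h1 : ∑ i, q i ≤ 1) (i : Fin n) : q i ≤ 1 :=
  (Finset.single_le_sum (fun j _ => h0 j) (Finset.mem_univ i)).trans h1

theorem sum_subset_le_one (h0 : ∀ i, 0 ≤ q i) (h1 : ∑ i, q i ≤ 1) (S : Finset (Fin n)) :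
    ∑ i ∈ S, q i ≤ 1 :=
  (Finset.sum_le_sum_of_subset_of_nonneg (Finset.subset_univ S) fun i _ _ => h0 i).trans h1

/-- A union bound for the bidders other than `k`; it keeps the adjusted entry within `[0, 1]`. -/
theorem one_sub_sum_le_prod_erase (h0 : ∀ i, 0 ≤ q i) (h1 : ∑ i, q i ≤ 1)
    (S : Finset (Fin n)) (k : Fin n) :
    1 - ∑ i ∈ S, q i ≤ ∏ i ∈ S.erase k, (1 - q i) := by
  refine le_trans ?_ (one_sub_sum_le_prod_one_sub _ (fun i _ => h0 i)
    fun i _ => le_one_of_sum_le_one h0 h1 i)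
  have := Finset.sum_le_sum_of_subset_of_nonneg (Finset.erase_subset k S) fun i _ _ => h0 i
  linarith

theorem adjustAt_nonneg (h0 : ∀ i, 0 ≤ q i) (h1 : ∑ i, q i ≤ 1) (i : Fin n) :
    0 ≤ adjustAt S k q i := by
  unfold adjustAt
  rcases eq_or_ne i k with rfl | hi
  · rw [Function.update_self, sub_nonneg]
    have h := one_sub_sum_le_prod_erase h0 h1 S i
    exact div_le_one_of_le₀ h ((sub_nonneg.2 (sum_subset_le_one h0 h1 S)).trans h)
  · rw [Function.update_of_ne hi]
    exact h0 i

theorem adjustAt_le_one (h0 : ∀ i, 0 ≤ q i) (h1 : ∑ i, q i ≤ 1) (i : Fin n) :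
    adjustAt S k q i ≤ 1 := by
  unfold adjustAt
  rcases eq_or_ne i k with rfl | hi
  · rw [Function.update_self, sub_le_self_iff]
    have h := sub_nonneg.2 (sum_subset_le_one h0 h1 S)
    exact div_nonneg h (h.trans (one_sub_sum_le_prod_erase h0 h1 S i))
  · rw [Function.update_of_ne hi]
    exact le_one_of_sum_le_one h0 h1 i

theorem prod_one_sub_adjustAt (h0 : ∀ i, 0 ≤ q i) (h1 : ∑ i, q i ≤ 1) (hk : k ∈ S) :
    ∏ i ∈ S, (1 - adjustAt S k q i) = 1 - ∑ i ∈ S, q i := by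
  rw [← Finset.mul_prod_erase S _ hk, Finset.prod_congr (g := fun i => 1 - q i) rfl fun i hi => by
    rw [adjustAt, Function.update_of_ne (Finset.ne_of_mem_erase hi)], adjustAt,
    Function.update_self, sub_sub_cancel]
  -- If the denominator is zero, some other bidder has probability one, and then `1 - ∑ i ∈ S, q i`
  -- is zero as well.
  rcases eq_or_ne (∏ i ∈ S.erase k, (1 - q i)) 0 with h | h
  · have := one_sub_sum_le_prod_erase h0 h1 S k
    rw [h] at this ⊢
    linarith [sum_subset_le_one h0 h1 S]
  · exact div_mul_cancel₀ _ h

theorem secondStageProb_mul (h0 : ∀ i, 0 ≤ q i) (h1 : ∑ i, q i ≤ 1) :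
    (secondStageProb S q : ℝ) * (1 - ∑ i ∈ S, q i) = ∑ i ∈ Sᶜ, q i := by
  have hsum : ∑ i ∈ S, q i + ∑ i ∈ Sᶜ, q i ≤ 1 := by rwa [Finset.sum_add_sum_compl]
  have hc : 0 ≤ ∑ i ∈ Sᶜ, q i := Finset.sum_nonneg fun i _ => h0 i
  -- If `S` uses up all the probability, nothing is left for the complement and the value of the
  -- quotient does not matter.
  rcases (sub_nonneg.2 (sum_subset_le_one h0 h1 S)).eq_or_lt with h | h
  · rw [← h]; linarith
  · rw [secondStageProb, Set.projIcc_of_mem zero_le_one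
      ⟨div_nonneg hc h.le, (div_le_one h).2 (by linarith)⟩]
    exact div_mul_cancel₀ _ h.ne'

end Adjustment

/-! ### The mimicking auction: same qualities, an eighth of the revenue -/

namespace AdMDP

variable {n : ℕ} {M : AdMDP n}

theorem measurable_reserves (M : AdMDP n) : Measurable M.reserves :=
  measurable_pi_lambda _ fun i => (M.dist i).measurable_reserveAt.comp (measurable_pi_apply i)

theorem Policy.measurable_winProb (π : M.Policy) :
    Measurable fun ctr => fun i => M.winProb (π.mech ctr) i := by
  refine measurable_pi_lambda _ fun i => ?_
  have h : (fun ctr => M.winProb (π.mech ctr) i)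
      = fun ctr => (M.showProb (π.mech ctr) (some i)).toReal := by
    ext ctr
    rw [showProb_some, ENNReal.toReal_ofReal (winProb_nonneg _ i)]
  rw [h]
  exact (π.measurable_showProb (some i)).ennreal_toReal

/-- The two-stage auction that shows ads of `S` and ads of its complement as often as `a` does;
bidder `k` is given the reserve that adjusts the total probability. -/
noncomputable def mimic (M : AdMDP n) (a : Mechanism n) (S : Finset (Fin n)) (k : Fin n) :
    Mechanism n :=
  twoStageMech S (M.reserves (adjustAt S k (M.winProb a))) (secondStageProb S (M.winProb a))

/-- The policy that mimics the policy `π` in every state. -/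
noncomputable def mimicPolicy (π : M.Policy) (S : Finset (Fin n)) (k : Fin n) : M.Policy :=
  M.twoStagePolicy S (fun ctr => M.reserves (adjustAt S k (M.winProb (π.mech ctr))))
    (M.measurable_reserves.comp ((measurable_adjustAt S k).comp π.measurable_winProb))
    (fun ctr => secondStageProb S (M.winProb (π.mech ctr)))
    ((measurable_secondStageProb S).comp π.measurable_winProb)

theorem mimicPolicy_mech (π : M.Policy) (S : Finset (Fin n)) (k : Fin n) (ctr : unitInterval) :
    (mimicPolicy π S k).mech ctr = M.mimic (π.mech ctr) S k := rfl

variable (a : Mechanism n) {S : Finset (Fin n)} {k : Fin n}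

theorem sum_winProb_mimic (hk : k ∈ S) :
    ∑ i ∈ S, M.winProb (M.mimic a S k) i = ∑ i ∈ S, M.winProb a i := by
  have h0 := winProb_nonneg a (M := M)
  have h1 := sum_winProb_le_one a (M := M)
  rw [mimic, sum_winProb_twoStageMech_first (adjustAt_nonneg h0 h1) (adjustAt_le_one h0 h1),
    prod_one_sub_adjustAt h0 h1 hk, sub_sub_cancel]

theorem sum_winProb_mimic_compl (hk : k ∈ S) :
    ∑ i ∈ Sᶜ, M.winProb (M.mimic a S k) i = ∑ i ∈ Sᶜ, M.winProb a i := by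
  have h0 := winProb_nonneg a (M := M)
  have h1 := sum_winProb_le_one a (M := M)
  rcases Sᶜ.eq_empty_or_nonempty with h | h
  · simp [h]
  · rw [mimic, sum_winProb_twoStageMech_second (adjustAt_nonneg h0 h1) (adjustAt_le_one h0 h1) _ h,
      prod_one_sub_adjustAt h0 h1 hk, secondStageProb_mul h0 h1]

theorem showProb_none_mimic (hk : k ∈ S) :
    M.showProb (M.mimic a S k) none = M.showProb a none := by
  rw [showProb_none, showProb_none, ← Finset.sum_add_sum_compl S, sum_winProb_mimic a hk,
    sum_winProb_mimic_compl a hk, Finset.sum_add_sum_compl]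

theorem sum_showProb_some (T : Finset (Fin n)) :
    ∑ i ∈ T, M.showProb a (some i) = ENNReal.ofReal (∑ i ∈ T, M.winProb a i) := by
  simp_rw [showProb_some]
  rw [ENNReal.ofReal_sum_of_nonneg fun i _ => winProb_nonneg a i]

/-- A bound on the contribution of bidder `i` to the revenue of `a`. -/
noncomputable def exAnteRevenue (M : AdMDP n) (a : Mechanism n) (i : Fin n) : ℝ :=
  (M.reserves (M.winProb a) i).toReal * M.winProb a i

theorem exAnteRevenue_nonneg (i : Fin n) : 0 ≤ M.exAnteRevenue a i :=
  mul_nonneg ENNReal.toReal_nonneg (winProb_nonneg a i)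

theorem sum_meanPay_le (hreg : ∀ i, (M.dist i).Regular) :
    ∑ i, M.meanPay a i ≤ ∑ i, M.exAnteRevenue a i :=
  Finset.sum_le_sum fun i _ => meanPay_le_price_mul_winProb a i (hreg i)

/-- All bidders except `k` keep the reserves of the ex ante bound, and their probabilities sum to at
most one. -/
theorem sum_erase_le_mimic :
    ∑ i ∈ S.erase k, M.exAnteRevenue a i ≤ 2 * ∑ i, M.meanPay (M.mimic a S k) i := by
  have h0 := winProb_nonneg a (M := M)
  have h1 := sum_winProb_le_one a (M := M)
  have hadj : ∀ i ∈ S.erase k, adjustAt S k (M.winProb a) i = M.winProb a i := fun i hi =>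
    Function.update_of_ne (Finset.ne_of_mem_erase hi) _ _
  have h := half_sum_reserve_mul_le (M := M) (adjustAt_nonneg (S := S) (k := k) h0 h1)
    (adjustAt_le_one h0 h1)
    S (S.erase k) (Finset.erase_subset _ _) (by
      rw [Finset.sum_congr rfl hadj]; exact sum_subset_le_one h0 h1 _)
    (secondStageProb S (M.winProb a))
  refine le_trans (le_of_eq (Finset.sum_congr rfl fun i hi => ?_)) h
  rw [exAnteRevenue, reserves, reserves, hadj i hi]

/-- For a single bidder the adjustment changes nothing, so nobody has to be discarded. -/
theorem exAnteRevenue_le_mimic_singleton :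
    M.exAnteRevenue a k ≤ 2 * ∑ i, M.meanPay (M.mimic a {k} k) i := by
  have h0 := winProb_nonneg a (M := M)
  have h1 := sum_winProb_le_one a (M := M)
  have hadj : adjustAt {k} k (M.winProb a) k = M.winProb a k := by
    simp [adjustAt]
  have h := half_sum_reserve_mul_le (M := M) (adjustAt_nonneg (S := {k}) (k := k) h0 h1)
    (adjustAt_le_one h0 h1) {k} {k} subset_rfl (by
      rw [Finset.sum_singleton]; exact adjustAt_le_one h0 h1 k)
    (secondStageProb {k} (M.winProb a))
  rw [Finset.sum_singleton, hadj] at h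
  refine le_trans (le_of_eq ?_) h
  rw [exAnteRevenue, reserves, reserves, hadj]

open Classical in
/-- The ads with the same quality as ad `k`. -/
noncomputable def qualityClass {Q : Type*} (q : Fin n → Q) (k : Fin n) : Finset (Fin n) :=
  {i | q i = q k}

section TwoQualities

variable {Q : Type*} {q : Fin n → Q}

theorem mem_qualityClass {i : Fin n} : i ∈ qualityClass q k ↔ q i = q k := by
  simp [qualityClass]

theorem self_mem_qualityClass (k : Fin n) : k ∈ qualityClass q k := mem_qualityClass.2 rfl

theorem qualityClass_congr {k k' : Fin n} (h : q k = q k') :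
    qualityClass q k = qualityClass q k' := by
  ext i; rw [mem_qualityClass, mem_qualityClass, h]

theorem eq_of_ne_of_ne (hQ : Nat.card Q = 2) {x y z : Q} (hx : x ≠ z) (hy : y ≠ z) : x = y :=
  ((Nat.card_eq_two_iff' z).1 hQ).unique hx hy

theorem compl_qualityClass (hQ : Nat.card Q = 2) {k' : Fin n} (h : q k' ≠ q k) :
    (qualityClass q k)ᶜ = qualityClass q k' := by
  ext i
  rw [Finset.mem_compl, mem_qualityClass, mem_qualityClass]
  exact ⟨fun hi => eq_of_ne_of_ne hQ hi h, fun hi => by rwa [hi]⟩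

/-- One factor 2 for taking the quality with the larger ex ante revenue, one for discarding its
smallest contributor `k` (at most half if another bidder shares the quality), one from
inclusion-exclusion. If `k` is alone, a factor 4 suffices. -/
theorem exists_sum_meanPay_le_mimic (hreg : ∀ i, (M.dist i).Regular) (hQ : Nat.card Q = 2)
    [Nonempty (Fin n)] :
    ∃ k, ∑ i, M.meanPay a i ≤ 8 * ∑ i, M.meanPay (M.mimic a (qualityClass q k) k) i := by
  set g := M.exAnteRevenue a with hg
  have hg0 : ∀ i, 0 ≤ g i := exAnteRevenue_nonneg a
  obtain ⟨k₁, -, hk₁⟩ := Finset.exists_max_image Finset.univ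
    (fun k => ∑ i ∈ qualityClass q k, g i) Finset.univ_nonempty
  obtain ⟨k, hk, hmin⟩ := Finset.exists_min_image (qualityClass q k₁) g
    ⟨k₁, self_mem_qualityClass k₁⟩
  rw [← qualityClass_congr (mem_qualityClass.1 hk)] at hmin
  replace hk₁ : ∀ k', ∑ i ∈ qualityClass q k', g i ≤ ∑ i ∈ qualityClass q k, g i := fun k' => by
    rw [qualityClass_congr (mem_qualityClass.1 hk)]
    exact hk₁ k' (Finset.mem_univ _)
  refine ⟨k, (sum_meanPay_le a hreg).trans ?_⟩
  have hhalf : ∑ i, g i ≤ 2 * ∑ i ∈ qualityClass q k, g i := by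
    rw [← Finset.sum_add_sum_compl (qualityClass q k), two_mul]
    refine add_le_add le_rfl ?_
    rcases (qualityClass q k)ᶜ.eq_empty_or_nonempty with h | ⟨k', hk'⟩
    · rw [h, Finset.sum_empty]
      exact Finset.sum_nonneg fun i _ => hg0 i
    · rw [Finset.mem_compl, mem_qualityClass] at hk'
      rw [compl_qualityClass hQ hk']
      exact hk₁ k'
  have hself := self_mem_qualityClass (q := q) k
  rcases ((qualityClass q k).erase k).eq_empty_or_nonempty with h | ⟨j, hj⟩
  · have hS : qualityClass q k = {k} := by
      rw [← Finset.insert_erase hself, h]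
      rfl
    have := exAnteRevenue_le_mimic_singleton a (M := M) (k := k)
    have h0 := Finset.sum_nonneg fun i (_ : i ∈ Finset.univ) =>
      meanPay_nonneg (M.mimic a {k} k) i (M := M)
    rw [hS, Finset.sum_singleton] at hhalf
    rw [hS]
    linarith
  · have h1 := sum_erase_le_mimic a (M := M) (S := qualityClass q k) (k := k)
    have h2 : g k ≤ ∑ i ∈ (qualityClass q k).erase k, g i :=
      (hmin j (Finset.mem_of_mem_erase hj)).trans
        (Finset.single_le_sum (fun i _ => hg0 i) hj)
    rw [← Finset.add_sum_erase _ _ hself] at hhalf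
    linarith

theorem exists_expectedPayment_div_le_mimic (hreg : ∀ i, (M.dist i).Regular)
    (hQ : Nat.card Q = 2) [Nonempty (Fin n)] :
    ∃ k, M.expectedPayment a / 8 ≤ M.expectedPayment (M.mimic a (qualityClass q k) k) := by
  obtain ⟨k, hk⟩ := exists_sum_meanPay_le_mimic a hreg hQ (q := q)
  refine ⟨k, ENNReal.div_le_of_le_mul' ?_⟩
  rw [expectedPayment_eq, expectedPayment_eq, ← ENNReal.ofReal_ofNat,
    ← ENNReal.ofReal_mul (by norm_num)]
  exact ENNReal.ofReal_le_ofReal hk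

theorem qualityProb_mimic (hQ : Nat.card Q = 2) (c : Q) :
    M.qualityProb q (M.mimic a (qualityClass q k) k) c = M.qualityProb q a c := by
  classical
  have hk := self_mem_qualityClass (q := q) k
  unfold qualityProb
  rw [sum_showProb_some, sum_showProb_some]
  by_cases hc : c = q k
  · have : (Finset.univ.filter fun i => q i = c) = qualityClass q k := by
      ext i; simp [mem_qualityClass, hc]
    convert congrArg ENNReal.ofReal (sum_winProb_mimic a hk (M := M)) using 3
  · have : (Finset.univ.filter fun i => q i = c) = (qualityClass q k)ᶜ := by
      ext i
      simp only [Finset.mem_filter, Finset.mem_univ, true_and, Finset.mem_compl, mem_qualityClass]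
      exact ⟨fun hi => by rwa [hi], fun hi => eq_of_ne_of_ne hQ hi hc⟩
    convert congrArg ENNReal.ofReal (sum_winProb_mimic_compl a hk (M := M)) using 3

/-- On ads with a common kernel only the total showing probability enters the transition. -/
theorem sum_showProb_smul_congr {a a' : Mechanism n} {T : Finset (Fin n)} {ctr : unitInterval}
    (hT : ∀ i ∈ T, ∀ j ∈ T, M.P (some i) = M.P (some j))
    (h : ∑ i ∈ T, M.winProb a i = ∑ i ∈ T, M.winProb a' i) :
    ∑ i ∈ T, M.showProb a (some i) • M.P (some i) ctr
      = ∑ i ∈ T, M.showProb a' (some i) • M.P (some i) ctr := by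
  rcases T.eq_empty_or_nonempty with rfl | ⟨j, hj⟩
  · simp
  · have key : ∀ a : Mechanism n, ∑ i ∈ T, M.showProb a (some i) • M.P (some i) ctr
        = ENNReal.ofReal (∑ i ∈ T, M.winProb a i) • M.P (some j) ctr := fun a => by
      rw [← sum_showProb_some, Finset.sum_smul]
      exact Finset.sum_congr rfl fun i hi => by rw [hT i hi j hj]
    rw [key, key, h]

theorem sum_showProb_smul_mimic (hQ : Nat.card Q = 2)
    (hP : ∀ i j, q i = q j → M.P (some i) = M.P (some j)) (ctr : unitInterval) :
    ∑ o, M.showProb (M.mimic a (qualityClass q k) k) o • M.P o ctr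
      = ∑ o, M.showProb a o • M.P o ctr := by
  have hk := self_mem_qualityClass (q := q) k
  rw [Fintype.sum_option, Fintype.sum_option, showProb_none_mimic a hk,
    ← Finset.sum_add_sum_compl (qualityClass q k),
    ← Finset.sum_add_sum_compl (qualityClass q k) fun i => M.showProb a (some i) • _,
    sum_showProb_smul_congr (fun i hi j hj => hP i j
      ((mem_qualityClass.1 hi).trans (mem_qualityClass.1 hj).symm)) (sum_winProb_mimic a hk),
    sum_showProb_smul_congr (fun i hi j hj => hP i j ?_) (sum_winProb_mimic_compl a hk)]
  rw [Finset.mem_compl, mem_qualityClass] at hi hj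
  exact eq_of_ne_of_ne hQ hi hj

end TwoQualities

/-! ### Measurable selection and conclusion -/

/-- A policy may choose, measurably in the state, among finitely many policies. -/
theorem exists_select_policy [Nonempty (Fin n)] (π : Fin n → M.Policy)
    {G : Fin n → Set unitInterval} (hG : ∀ k, MeasurableSet (G k)) (hcover : ∀ ctr, ∃ k, ctr ∈ G k) :
    ∃ π' : M.Policy, ∀ ctr, ∃ k, ctr ∈ G k ∧ π'.mech ctr = (π k).mech ctr := by
  classical
  -- Taking the least admissible index makes the choice measurable.
  have hex : ∀ ctr, ∃ m : ℕ, ∃ h : m < n, ctr ∈ G ⟨m, h⟩ := fun ctr => by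
    obtain ⟨k, hk⟩ := hcover ctr
    exact ⟨k, k.2, hk⟩
  have hmeas : ∀ m : ℕ, MeasurableSet {ctr | ∃ h : m < n, ctr ∈ G ⟨m, h⟩} := fun m => by
    by_cases h : m < n
    · simpa [h] using hG ⟨m, h⟩
    · simp [h]
  set κ : unitInterval → Fin n := fun ctr => ⟨Nat.find (hex ctr), (Nat.find_spec (hex ctr)).1⟩
  have hκG : ∀ ctr, ctr ∈ G (κ ctr) := fun ctr => (Nat.find_spec (hex ctr)).2
  have hκ : Measurable κ := by
    have hfind : Measurable fun ctr => Nat.find (hex ctr) := measurable_find hex hmeas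
    refine measurable_to_countable' fun k => ?_
    have : κ ⁻¹' {k} = (fun ctr => Nat.find (hex ctr)) ⁻¹' {(k : ℕ)} := by
      ext ctr
      simp [κ, Fin.ext_iff]
    rw [this]
    exact hfind (measurableSet_singleton _)
  have hsel : ∀ f : Fin n → unitInterval → ℝ≥0∞, (∀ k, Measurable (f k)) →
      Measurable fun ctr => f (κ ctr) ctr := fun f hf =>
    (measurable_from_prod_countable_left (f := fun p : unitInterval × Fin n => f p.2 p.1)
      hf).comp (measurable_id.prodMk hκ)
  exact ⟨⟨fun ctr => (π (κ ctr)).mech ctr,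
    fun o => hsel (fun k ctr => M.showProb ((π k).mech ctr) o) fun k => (π k).measurable_showProb o,
    hsel (fun k ctr => M.expectedPayment ((π k).mech ctr)) fun k => (π k).measurable_expectedPayment⟩,
    fun ctr => ⟨κ ctr, hκG ctr, rfl⟩⟩

theorem Policy.stateLaw_congr {π π' : M.Policy} (h : ∀ ctr, π.transition ctr = π'.transition ctr)
    (ctr : unitInterval) (t : ℕ) : π.stateLaw ctr t = π'.stateLaw ctr t := by
  have hk : π.transition = π'.transition := Kernel.ext h
  induction t with
  | zero => rfl
  | succ t ih => rw [Policy.stateLaw, Policy.stateLaw, ih, hk]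

/-- With equal state laws both policies integrate against the same measure in each round, so the
statewise comparison of rewards passes to the discounted sums. -/
theorem Policy.value_div_le {π π' : M.Policy} {B : ℝ≥0∞}
    (hs : ∀ ctr t, π.stateLaw ctr t = π'.stateLaw ctr t)
    (hr : ∀ ctr, M.reward (π'.mech ctr) ctr / B ≤ M.reward (π.mech ctr) ctr)
    (ctr : unitInterval) : π'.value ctr / B ≤ π.value ctr := by
  unfold Policy.value
  rw [div_eq_mul_inv, ← ENNReal.tsum_mul_right]
  refine ENNReal.tsum_le_tsum fun t => ?_
  rw [mul_assoc, ← lintegral_mul_const _ π'.measurable_reward, hs]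
  gcongr with c
  exact hr c

end AdMDP

theorem theorem2 {n : ℕ} (M : AdMDP n) (hreg : ∀ i, (M.dist i).Regular)
    {Q : Type*} (hQ : Nat.card Q = 2) (q : Fin n → Q)
    (hP : ∀ i j, q i = q j → M.P (some i) = M.P (some j)) :
    ∃ π : M.Policy,
      -- in every state `π` runs a two-stage second-price auction with personalized reserves,
      -- whose first stage is among the ads of one of the two qualities
      (∀ ctr, ∃ T : TwoStage n, M.IsTwoStage (π.mech ctr) T ∧
        ∃ c : Q, ∀ i, i ∈ T.S₁ ↔ q i = c) ∧
      -- it is an 8-approximation to the optimal long-term discounted revenue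
      (∀ ctr, M.optValue ctr / 8 ≤ π.value ctr) ∧
      -- comparison with an optimal policy, round by round
      ∃ πopt : M.Policy, (∀ ctr, πopt.value ctr = M.optValue ctr) ∧
        (∀ ctr c, M.qualityProb q (π.mech ctr) c = M.qualityProb q (πopt.mech ctr) c) ∧
        (∀ ctr t, π.stateLaw ctr t = πopt.stateLaw ctr t) ∧
        (∀ ctr, M.reward (πopt.mech ctr) ctr / 8 ≤ M.reward (π.mech ctr) ctr) := by
  obtain ⟨πopt, hopt⟩ := AdMDP.exists_optimal_policy hreg
  suffices h : ∃ π : M.Policy,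
      (∀ ctr, ∃ T : TwoStage n, M.IsTwoStage (π.mech ctr) T ∧ ∃ c : Q, ∀ i, i ∈ T.S₁ ↔ q i = c) ∧
      (∀ ctr c, M.qualityProb q (π.mech ctr) c = M.qualityProb q (πopt.mech ctr) c) ∧
      (∀ ctr t, π.stateLaw ctr t = πopt.stateLaw ctr t) ∧
      (∀ ctr, M.reward (πopt.mech ctr) ctr / 8 ≤ M.reward (π.mech ctr) ctr) by
    obtain ⟨π, h1, h2, h3, h4⟩ := h
    exact ⟨π, h1, fun ctr => hopt ctr ▸ AdMDP.Policy.value_div_le h3 h4 ctr, πopt, hopt, h2, h3, h4⟩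
  -- Without advertisers every mechanism is vacuously two-stage, and the optimal policy itself
  -- serves.
  rcases isEmpty_or_nonempty (Fin n) with hn | hn
  · have hQne : Nonempty Q := (Nat.card_ne_zero.1 (by rw [hQ]; norm_num)).1
    refine ⟨πopt, fun ctr => ⟨TwoStage.ofReserves ∅ 0 0, fun b _ =>
      ⟨Subsingleton.elim _ _, Subsingleton.elim _ _⟩, Classical.arbitrary Q, fun i => hn.elim i⟩,
      fun _ _ => rfl, fun _ _ => rfl, fun ctr => ?_⟩
    exact ENNReal.div_le_of_le_mul' (le_mul_of_one_le_left' (by norm_num))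
  -- The adjusted bidder, and with it the first-stage quality, depends on the state; the sets of
  -- states where bidder `k` achieves the factor 8 are measurable and cover everything.
  · obtain ⟨π, hπ⟩ := AdMDP.exists_select_policy
      (fun k => AdMDP.mimicPolicy πopt (AdMDP.qualityClass q k) k)
      (G := fun k => {ctr | M.expectedPayment (πopt.mech ctr) / 8
        ≤ M.expectedPayment (M.mimic (πopt.mech ctr) (AdMDP.qualityClass q k) k)})
      (fun k => measurableSet_le (πopt.measurable_expectedPayment.div_const _)
        (AdMDP.mimicPolicy πopt (AdMDP.qualityClass q k) k).measurable_expectedPayment)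
      fun ctr => AdMDP.exists_expectedPayment_div_le_mimic (πopt.mech ctr) hreg hQ
    refine ⟨π, fun ctr => ?_, fun ctr c => ?_, AdMDP.Policy.stateLaw_congr fun ctr => ?_,
      fun ctr => ?_⟩ <;> obtain ⟨k, hk, hmech⟩ := hπ ctr <;>
      rw [AdMDP.mimicPolicy_mech] at hmech
    · rw [hmech]
      exact ⟨_, isTwoStage_twoStageMech M _ _ _, q k, fun i => AdMDP.mem_qualityClass⟩
    · rw [hmech, AdMDP.qualityProb_mimic _ hQ]
    · change ∑ o, M.showProb (π.mech ctr) o • M.P o ctr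
        = ∑ o, M.showProb (πopt.mech ctr) o • M.P o ctr
      rw [hmech, AdMDP.sum_showProb_smul_mimic _ hQ hP]
    · rw [hmech, AdMDP.reward, AdMDP.reward, mul_div_assoc]
      gcongr
      exact hk
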